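/- A tree is a partial order $(T,\preceq)$ with a least element in which, for every $n\in T$, the set $\{m\in T : m\preceq n\}$ is finite and linearly ordered. A path in $T$ is an infinite maximal linearly ordered subset; a path $P$ is isolated if some $n\in P$ lies on no path other than $P$. A maximal infinite node is a node $n$ such that $T(n)=\{m : n\preceq m\}$ is infinite but $T(m)$ is finite for every $m\succ n$. $T$ is of type 3 if it is infinite and has no maximal infinite node and no isolated path. $T$ is computable if $T$ is a computable subset of $\omega$ and $\preceq$ is a computable relation. A self-embedding of $T$ is an injective map $\delta:T\to T$ with $n\preceq m \iff \delta(n)\preceq\delta(m)$ for all $n,m\in T$; it is nontrivial if it is not onto. Let $\leq_T$ denote Turing reducibility, $\oplus$ the join, and $0'$ and $0''$ the first and the second Turing jump of the empty set. Theorem. There is a computable type 3 tree $S$ such that for every computable tree $\hat S$ isomorphic to $S$ as a partial order (by an isomorphism that need not be computable) and every nontrivial self-embedding $\delta:\hat S\to\hat S$, $0''\leq_T 0'\oplus\delta$. In particular, no such $\hat S$ has a $\Delta^0_2$ nontrivial self-embedding, and no such $\hat S$ has a nontrivial self-embedding $\delta$ with $0'<_T\delta<_T 0''$. -/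

import Mathlib

open scoped Computability

/-! ### Trees as partial orders -/

section Trees

variable (T : Type) [PartialOrder T]

/-- A tree: a partial order with a least element (the root) in which the predecessors of every
node form a finite linearly ordered set. -/
structure IsTree : Prop where
  exists_root : ∃ r : T, ∀ n : T, r ≤ n
  finite_below : ∀ n : T, {m : T | m ≤ n}.Finite
  chain_below : ∀ n : T, IsChain (· ≤ ·) {m : T | m ≤ n}

variable {T}

/-- `n` is an infinite node: the subtree `T(n)` of all `m` above `n` is infinite. -/
def IsInfiniteNode (n : T) : Prop := {m : T | n ≤ m}.Infinite

/-- `n` is a maximal infinite node: `T(n)` is infinite, but `T(m)` is finite for all `m`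
strictly above `n`. -/
def IsMaximalInfiniteNode (n : T) : Prop :=
  IsInfiniteNode n ∧ ∀ m : T, n < m → ¬ IsInfiniteNode m

/-- A path: an infinite maximal linearly ordered subset. -/
def IsTreePath (P : Set T) : Prop := P.Infinite ∧ IsMaxChain (· ≤ ·) P

/-- An isolated path: it has a node `n` such that it is the only path containing `n`. -/
def IsIsolatedPath (P : Set T) : Prop :=
  IsTreePath P ∧ ∃ n ∈ P, ∀ Q : Set T, IsTreePath Q → n ∈ Q → Q = P

variable (T)

/-- Type 3: infinite, with no maximal infinite node and no isolated path. -/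
structure IsTypeThree : Prop where
  infinite : Infinite T
  no_maximal_infinite_node : ∀ n : T, ¬ IsMaximalInfiniteNode n
  no_isolated_path : ∀ P : Set T, ¬ IsIsolatedPath P

end Trees

/-! ### Trees on sets of natural numbers -/

/-- A tree whose set of nodes is a subset of `ℕ`. The tree order has nothing to do with the usual
order on `ℕ`. -/
structure NatTree where
  carrier : Set ℕ
  order : PartialOrder carrier
  isTree : IsTree carrier

namespace NatTree

/-- The nodes of `T`, as a type that carries the tree order (and not the order of `ℕ`). -/
def Node (T : NatTree) : Type := T.carrier

instance (T : NatTree) : PartialOrder T.Node := T.order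

/-- The node given by an element of the underlying set. -/
def node (T : NatTree) (n : ℕ) (h : n ∈ T.carrier) : T.Node := (⟨n, h⟩ : T.carrier)

/-- The natural number that a node is. -/
def val (T : NatTree) (x : T.Node) : ℕ := Subtype.val (p := (· ∈ T.carrier)) x

/-- A computable tree: the set of nodes is computable, and so is the tree order. -/
structure IsComputable (T : NatTree) : Prop where
  carrier : ComputablePred fun n : ℕ => n ∈ T.carrier
  order : ComputablePred fun p : ℕ × ℕ =>
    ∃ (h₁ : p.1 ∈ T.carrier) (h₂ : p.2 ∈ T.carrier), T.node p.1 h₁ ≤ T.node p.2 h₂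

open Classical in
/-- A self-map of the nodes as a number-theoretic function, with value `0` off the set of nodes.
For a computable tree this has the same Turing degree as the graph of the map. -/
noncomputable def mapFun (T : NatTree) (δ : T.Node → T.Node) : ℕ → ℕ := fun n =>
  if h : n ∈ T.carrier then T.val (δ (T.node n h)) else 0

/-- The graph of a self-map of the nodes, as a set of pairs of natural numbers. -/
def graph (T : NatTree) (δ : T.Node → T.Node) : Set (ℕ × ℕ) :=
  {p | ∃ h : p.1 ∈ T.carrier, T.val (δ (T.node p.1 h)) = p.2}

end NatTree

/-! ### The Turing jump -/

/-- Programs with an oracle, one for each clause of `Nat.RecursiveIn`. -/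
inductive OracleCode : Type
  | zero : OracleCode
  | succ : OracleCode
  | left : OracleCode
  | right : OracleCode
  | oracle : OracleCode
  | pair : OracleCode → OracleCode → OracleCode
  | comp : OracleCode → OracleCode → OracleCode
  | prec : OracleCode → OracleCode → OracleCode
  | rfind : OracleCode → OracleCode

namespace OracleCode

/-- The partial function that a program computes with the oracle `g`. -/
def eval (g : ℕ → ℕ) : OracleCode → ℕ →. ℕ
  | zero => fun _ => Part.some 0
  | succ => fun n => Part.some (n + 1)
  | left => fun n => Part.some (Nat.unpair n).1
  | right => fun n => Part.some (Nat.unpair n).2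
  | oracle => fun n => Part.some (g n)
  | pair c d => fun n => Nat.pair <$> eval g c n <*> eval g d n
  | comp c d => fun n => eval g d n >>= eval g c
  | prec c d => fun p =>
      let (a, n) := Nat.unpair p
      n.rec (eval g c a) fun y IH => do
        let i ← IH
        eval g d (Nat.pair a (Nat.pair y i))
  | rfind c => fun a => Nat.rfind fun n => (fun m => m = 0) <$> eval g c (Nat.pair a n)

/-- The Gödel number of a program. -/
def encode : OracleCode → ℕ
  | zero => 0
  | succ => 1
  | left => 2
  | right => 3
  | oracle => 4
  | pair c d => 4 * Nat.pair (encode c) (encode d) + 5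
  | comp c d => 4 * Nat.pair (encode c) (encode d) + 6
  | prec c d => 4 * Nat.pair (encode c) (encode d) + 7
  | rfind c => 4 * encode c + 8

theorem encode_injective : Function.Injective encode := by
  intro c
  induction c with
  | zero | succ | left | right | oracle =>
    intro d h
    cases d <;> simp only [encode] at h <;> first | rfl | omega
  | pair a b iha ihb | comp a b iha ihb | prec a b iha ihb =>
    intro d h
    cases d <;> simp only [encode, Nat.add_right_cancel_iff, Nat.mul_right_inj (by decide : 4 ≠ 0),
      Nat.pair_eq_pair] at h <;> first
      | omega
      | rw [iha h.1, ihb h.2]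
  | rfind a iha =>
    intro d h
    cases d <;> simp only [encode, Nat.add_right_cancel_iff,
      Nat.mul_right_inj (by decide : 4 ≠ 0)] at h <;> first
      | omega
      | rw [iha h]

/-- The programs compute exactly the partial functions that are recursive in the oracle. -/
theorem exists_code (g : ℕ → ℕ) (f : ℕ →. ℕ) :
    f ≤ᵀ (g : ℕ →. ℕ) ↔ ∃ c : OracleCode, c.eval g = f := by
  rw [TuringReducible, RecursiveIn.iff_nat]
  constructor
  · intro h
    induction h with
    | zero => exact ⟨zero, rfl⟩
    | succ => exact ⟨succ, rfl⟩
    | left => exact ⟨left, rfl⟩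
    | right => exact ⟨right, rfl⟩
    | oracle f hf => exact ⟨oracle, (Set.mem_singleton_iff.1 hf).symm⟩
    | pair _ _ iha ihb =>
      obtain ⟨a, rfl⟩ := iha; obtain ⟨b, rfl⟩ := ihb; exact ⟨pair a b, rfl⟩
    | comp _ _ iha ihb =>
      obtain ⟨a, rfl⟩ := iha; obtain ⟨b, rfl⟩ := ihb; exact ⟨comp a b, rfl⟩
    | prec _ _ iha ihb =>
      obtain ⟨a, rfl⟩ := iha; obtain ⟨b, rfl⟩ := ihb; exact ⟨prec a b, rfl⟩
    | rfind _ iha =>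
      obtain ⟨a, rfl⟩ := iha; exact ⟨rfind a, rfl⟩
  · rintro ⟨c, rfl⟩
    induction c with
    | zero => exact .zero
    | succ => exact .succ
    | left => exact .left
    | right => exact .right
    | oracle => exact .oracle _ rfl
    | pair _ _ iha ihb => exact .pair iha ihb
    | comp _ _ iha ihb => exact .comp iha ihb
    | prec _ _ iha ihb => exact .prec iha ihb
    | rfind _ iha => exact .rfind iha

end OracleCode

open Classical in
/-- The characteristic function of a set of natural numbers. -/
noncomputable def charFun (A : Set ℕ) : ℕ → ℕ := fun n => if n ∈ A then 1 else 0

/-- The Turing jump of `A`: the numbers `e` such that the `e`-th program with oracle `A` halts on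
input `e`. -/
def turingJump (A : Set ℕ) : Set ℕ :=
  {e | ∃ c : OracleCode, c.encode = e ∧ (c.eval (charFun A) e).Dom}

/-- The characteristic function of `0'`, the jump of the empty set. -/
noncomputable def zeroJump : ℕ → ℕ := charFun (turingJump ∅)

/-- The characteristic function of `0''`, the jump of `0'`. -/
noncomputable def zeroDoubleJump : ℕ → ℕ := charFun (turingJump (turingJump ∅))

/-- The join `f ⊕ g`: `f` on the even and `g` on the odd numbers. -/
def turingJoin (f g : ℕ → ℕ) : ℕ → ℕ := fun n => if n % 2 = 0 then f (n / 2) else g (n / 2)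

/-- `f` is Turing reducible to `g`, but `g` is not Turing reducible to `f`. -/
def StrictTuringReducible (f g : ℕ → ℕ) : Prop :=
  (f : ℕ →. ℕ) ≤ᵀ (g : ℕ →. ℕ) ∧ ¬ (g : ℕ →. ℕ) ≤ᵀ (f : ℕ →. ℕ)

/-! ### The class `Δ⁰₂` -/

/-- `A` is `Σ⁰₂`: membership is of the form `∃ x, ∀ y, R` with a computable relation `R`. -/
def IsSigmaTwo (A : Set (ℕ × ℕ)) : Prop :=
  ∃ R : (ℕ × ℕ) × ℕ × ℕ → Prop, ComputablePred R ∧ ∀ a, a ∈ A ↔ ∃ x, ∀ y, R (a, x, y)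

/-- `A` is `Π⁰₂`: membership is of the form `∀ x, ∃ y, R` with a computable relation `R`. -/
def IsPiTwo (A : Set (ℕ × ℕ)) : Prop :=
  ∃ R : (ℕ × ℕ) × ℕ × ℕ → Prop, ComputablePred R ∧ ∀ a, a ∈ A ↔ ∀ x, ∃ y, R (a, x, y)

/-- `A` is `Δ⁰₂`: both `Σ⁰₂` and `Π⁰₂`. -/
def IsDeltaTwo (A : Set (ℕ × ℕ)) : Prop := IsSigmaTwo A ∧ IsPiTwo A

/-! Fix a `Σ⁰₂` definition of `0''` and let f(e) be one plus the least witness for e, or 0 if there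
is none. With the help of `0'`, any function dominating f decides `0''`, because a bound on the
witness turns the `Σ⁰₂` question into a `Π⁰₁` one (`zeroDoubleJump_le_of_dominating`). It is
therefore enough to force every nontrivial self-embedding to grow fast.

The codes b₀ < b₁ < … of the initial segments of f form a `Π⁰₂` set B with f(i) < b_{i+1}
(`levelMatrix_iff`, `leastWitness_lt_witnessCode`). The tree S consists of the binary strings in
which a right turn at level i survives to length n only if the first n instances of the `Π⁰₂`
condition on i hold. A right turn at a level outside B thus has only finitely many nodes above it,
and the infinite nodes split exactly at the levels in B (`GuardedTree.isInfiniteNode_iff`). As B is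
infinite, S is of type 3.

A nontrivial self-embedding raises the level of some infinite node; otherwise it would permute
finite sets that exhaust the tree (`GuardedTree.exists_isLive_level_lt`). Every node above that one
is raised too. Take an infinite node above it at a level b in B: the images of its two infinite
successors separate at a level that is again in B and exceeds b (`GuardedTree.exists_level_jump`).
So from some n on, some node of level b_n + 1 has an image of level greater than b_{n+1}.

Levels are preserved by isomorphism. In any computable copy, `0'` bounds the nodes of a given level,
since the tree is finitely branching, and bounds the level of a given node. Iterating δ between
these bounds, `0' ⊕ δ` dominates a tail of the sequence b_n
(`NatTree.IsComputable.exists_dominating`), hence f. -/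

namespace OracleCode

/-! ### Oracle computations with partial oracles -/

/-- `OracleCode.eval` with a partial oracle. -/
def evalPart (h : ℕ → Part ℕ) : OracleCode → ℕ → Part ℕ
  | zero => fun _ => Part.some 0
  | succ => fun n => Part.some (n + 1)
  | left => fun n => Part.some (Nat.unpair n).1
  | right => fun n => Part.some (Nat.unpair n).2
  | oracle => h
  | pair c d => fun n =>
      (evalPart h c n).bind fun a => (evalPart h d n).map fun b => Nat.pair a b
  | comp c d => fun n => (evalPart h d n).bind fun a => evalPart h c a
  | prec c d => fun p =>
      (Nat.unpair p).2.rec (evalPart h c (Nat.unpair p).1) fun y IH =>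
        IH.bind fun i => evalPart h d (Nat.pair (Nat.unpair p).1 (Nat.pair y i))
  | rfind c => fun a => Nat.rfind fun n =>
      (evalPart h c (Nat.pair a n)).map fun m => decide (m = 0)

theorem evalPart_coe (g : ℕ → ℕ) (c : OracleCode) :
    evalPart (fun n => Part.some (g n)) c = eval g c := by
  induction c with
  | zero | succ | left | right | oracle => rfl
  | pair c d ihc ihd =>
    funext n
    simp only [evalPart, eval, ihc, ihd, Seq.seq, Part.map_eq_map, Part.bind_map]
  | comp c d ihc ihd | prec c d ihc ihd => simp only [evalPart, eval, ihc, ihd]; rfl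
  | rfind c ihc => simp only [evalPart, eval, ihc]; rfl

/-- Continuity of evaluation in the oracle. -/
theorem evalPart_eventually {h : ℕ → ℕ → Part ℕ} {h' : ℕ → Part ℕ}
    (H : ∀ n, ∀ v ∈ h' n, ∀ᶠ k in Filter.atTop, v ∈ h k n) (c : OracleCode) :
    ∀ n, ∀ v ∈ evalPart h' c n, ∀ᶠ k in Filter.atTop, v ∈ evalPart (h k) c n := by
  induction c with
  | zero | succ | left | right =>
    intro n v hv
    exact Filter.Eventually.of_forall fun _ => hv
  | oracle => exact H
  | pair c d ihc ihd =>
    intro n v hv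
    simp only [evalPart, Part.mem_bind_iff, Part.mem_map_iff] at hv ⊢
    obtain ⟨a, ha, b, hb, rfl⟩ := hv
    filter_upwards [ihc n a ha, ihd n b hb] with k h₁ h₂
    exact ⟨a, h₁, b, h₂, rfl⟩
  | comp c d ihc ihd =>
    intro n v hv
    simp only [evalPart, Part.mem_bind_iff] at hv ⊢
    obtain ⟨a, ha, hb⟩ := hv
    filter_upwards [ihd n a ha, ihc a v hb] with k h₁ h₂
    exact ⟨a, h₁, h₂⟩
  | prec c d ihc ihd =>
    intro p v hv
    simp only [evalPart] at hv ⊢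
    generalize (Nat.unpair p).2 = m at hv ⊢
    induction m generalizing v with
    | zero => exact ihc _ v hv
    | succ m ih =>
      simp only [Part.mem_bind_iff] at hv ⊢
      obtain ⟨a, ha, hb⟩ := hv
      filter_upwards [ih a ha, ihd _ v hb] with k h₁ h₂
      exact ⟨a, h₁, h₂⟩
  | rfind c ihc =>
    intro n v hv
    simp only [evalPart] at hv ⊢
    replace hv := Nat.mem_rfind.1 hv
    simp only [Part.mem_map_iff] at hv
    obtain ⟨⟨a, ha, ha'⟩, hb⟩ := hv
    have h₂ : ∀ᶠ k in Filter.atTop, ∀ m ∈ Set.Iio v,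
        ∃ a ∈ evalPart (h k) c (Nat.pair n m), decide (a = 0) = false := by
      rw [Filter.eventually_all_finite (Set.finite_Iio v)]
      intro m hm
      obtain ⟨b, hb, hb'⟩ := hb hm
      filter_upwards [ihc _ b hb] with k hk
      exact ⟨b, hk, hb'⟩
    filter_upwards [ihc _ a ha, h₂] with k h₁ h₂
    exact Nat.mem_rfind.2 ⟨(Part.mem_map_iff _).2 ⟨a, h₁, ha'⟩,
      fun {m} hm => (Part.mem_map_iff _).2 (h₂ m hm)⟩

/-- Continuity applied to a constant sequence of oracles. -/
theorem evalPart_mono {h h' : ℕ → Part ℕ} (H : ∀ n, ∀ v ∈ h n, v ∈ h' n) (c : OracleCode) (n : ℕ) :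
    ∀ v ∈ evalPart h c n, v ∈ evalPart h' c n := fun v hv =>
  Filter.eventually_const.1 (evalPart_eventually (h := fun _ => h') (h' := h)
    (fun n v hv => Filter.Eventually.of_forall fun _ => H n v hv) c n v hv)

theorem encode_surjective : Function.Surjective encode := by
  intro e
  induction e using Nat.strong_induction_on with
  | _ e ih =>
    rcases lt_or_ge e 5 with h | h
    · interval_cases e
      exacts [⟨zero, rfl⟩, ⟨succ, rfl⟩, ⟨left, rfl⟩, ⟨right, rfl⟩, ⟨oracle, rfl⟩]
    · have hl := Nat.unpair_left_le ((e - 5) / 4)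
      have hr := Nat.unpair_right_le ((e - 5) / 4)
      obtain ⟨c, hc⟩ := ih ((e - 5) / 4).unpair.1 (by omega)
      obtain ⟨d, hd⟩ := ih ((e - 5) / 4).unpair.2 (by omega)
      obtain ⟨r, hr⟩ := ih ((e - 5) / 4) (by omega)
      have hm : (e - 5) % 4 = 0 ∨ (e - 5) % 4 = 1 ∨ (e - 5) % 4 = 2 ∨ (e - 5) % 4 = 3 := by omega
      rcases hm with hm | hm | hm | hm
      · exact ⟨pair c d, by simp only [encode, hc, hd, Nat.pair_unpair]; omega⟩
      · exact ⟨comp c d, by simp only [encode, hc, hd, Nat.pair_unpair]; omega⟩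
      · exact ⟨prec c d, by simp only [encode, hc, hd, Nat.pair_unpair]; omega⟩
      · exact ⟨rfind r, by simp only [encode, hr]; omega⟩

/-! ### A universal oracle machine -/

open Nat.Partrec (Code)

/-- One step of the recursion that defines a universal machine: `call` stands for the machine
itself. -/
def step (h : ℕ → Part ℕ) (call : ℕ → ℕ → Part ℕ) (e n : ℕ) : Part ℕ :=
  bif e == 0 then Part.some 0 else
  bif e == 1 then Part.some (n + 1) else
  bif e == 2 then Part.some n.unpair.1 else
  bif e == 3 then Part.some n.unpair.2 else
  bif e == 4 then h n else
  bif (e - 5) % 4 == 0 then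
    (call ((e - 5) / 4).unpair.1 n).bind fun a =>
      (call ((e - 5) / 4).unpair.2 n).map fun b => Nat.pair a b else
  bif (e - 5) % 4 == 1 then
    (call ((e - 5) / 4).unpair.2 n).bind fun a => call ((e - 5) / 4).unpair.1 a else
  bif (e - 5) % 4 == 2 then
    n.unpair.2.rec (call ((e - 5) / 4).unpair.1 n.unpair.1) fun y IH =>
      IH.bind fun i => call ((e - 5) / 4).unpair.2 (Nat.pair n.unpair.1 (Nat.pair y i)) else
  Nat.rfind fun m => (call ((e - 5) / 4) (Nat.pair n m)).map fun b => decide (b = 0)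

section

variable {α : Type} [Primcodable α] {call : α → ℕ → ℕ → Part ℕ} {e n : α → ℕ}

theorem partrec_call (hc : Partrec fun x : α × ℕ × ℕ => call x.1 x.2.1 x.2.2) {γ : Type}
    [Primcodable γ] {f : γ → α} {a b : γ → ℕ} (hf : Computable f) (ha : Computable a)
    (hb : Computable b) : Partrec fun z => call (f z) (a z) (b z) :=
  hc.comp (hf.pair (ha.pair hb))

theorem computable_natPair {γ : Type} [Primcodable γ] {a b : γ → ℕ} (ha : Computable a)
    (hb : Computable b) : Computable fun z => Nat.pair (a z) (b z) :=
  Primrec₂.natPair.to_comp.comp ha hb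

theorem computable_fst_unpair {γ : Type} [Primcodable γ] {a : γ → ℕ} (ha : Computable a) :
    Computable fun z => (a z).unpair.1 := Computable.fst.comp (Computable.unpair.comp ha)

theorem computable_snd_unpair {γ : Type} [Primcodable γ] {a : γ → ℕ} (ha : Computable a) :
    Computable fun z => (a z).unpair.2 := Computable.snd.comp (Computable.unpair.comp ha)

theorem partrec_pair_call (hc : Partrec fun x : α × ℕ × ℕ => call x.1 x.2.1 x.2.2) {a b : α → ℕ}
    (ha : Computable a) (hb : Computable b) (hn : Computable n) :
    Partrec fun x => (call x (a x) (n x)).bind fun u =>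
      (call x (b x) (n x)).map fun v => Nat.pair u v := by
  refine Partrec.bind (partrec_call hc Computable.id ha hn) ?_
  refine Partrec.map (partrec_call hc Computable.fst (hb.comp Computable.fst)
    (hn.comp Computable.fst)) ?_
  exact computable_natPair (Computable.snd.comp Computable.fst) Computable.snd

theorem partrec_comp_call (hc : Partrec fun x : α × ℕ × ℕ => call x.1 x.2.1 x.2.2) {a b : α → ℕ}
    (ha : Computable a) (hb : Computable b) (hn : Computable n) :
    Partrec fun x => (call x (b x) (n x)).bind fun u => call x (a x) u :=
  Partrec.bind (partrec_call hc Computable.id hb hn)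
    (partrec_call hc Computable.fst (ha.comp Computable.fst) Computable.snd)

theorem partrec_prec_call (hc : Partrec fun x : α × ℕ × ℕ => call x.1 x.2.1 x.2.2) {a b m : α → ℕ}
    (ha : Computable a) (hb : Computable b) (hn : Computable n) (hm : Computable m) :
    Partrec fun x => (m x).rec (call x (a x) (n x)) fun y IH =>
      IH.bind fun i => call x (b x) (Nat.pair (n x) (Nat.pair y i)) := by
  refine Partrec.nat_rec (h := fun x z => call x (b x) (Nat.pair (n x) (Nat.pair z.1 z.2))) hm
    (partrec_call hc Computable.id ha hn) ?_
  exact partrec_call hc Computable.fst (hb.comp Computable.fst)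
    (computable_natPair (hn.comp Computable.fst)
      (computable_natPair (Computable.fst.comp Computable.snd) (Computable.snd.comp Computable.snd)))

theorem partrec_rfind_call (hc : Partrec fun x : α × ℕ × ℕ => call x.1 x.2.1 x.2.2) {a : α → ℕ}
    (ha : Computable a) (hn : Computable n) :
    Partrec fun x => Nat.rfind fun m =>
      (call x (a x) (Nat.pair (n x) m)).map fun b => decide (b = 0) := by
  refine Partrec.rfind (p := fun x m =>
    (call x (a x) (Nat.pair (n x) m)).map fun b => decide (b = 0)) ?_
  refine Partrec.map (partrec_call hc Computable.fst (ha.comp Computable.fst)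
    (computable_natPair (hn.comp Computable.fst) Computable.snd)) ?_
  exact Primrec.eq.decide.to_comp.comp Computable.snd (Computable.const 0)

theorem partrec_step {h : α → ℕ → Part ℕ} (hh : Partrec₂ h)
    (hc : Partrec fun x : α × ℕ × ℕ => call x.1 x.2.1 x.2.2)
    (he : Computable e) (hn : Computable n) :
    Partrec fun x => step (h x) (call x) (e x) (n x) := by
  have he5 : Computable fun x => e x - 5 := Primrec.nat_sub.to_comp.comp he (Computable.const 5)
  have hq : Computable fun x => (e x - 5) / 4 :=
    Primrec.nat_div.to_comp.comp he5 (Computable.const 4)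
  have hm : Computable fun x => (e x - 5) % 4 :=
    Primrec.nat_mod.to_comp.comp he5 (Computable.const 4)
  have beq : ∀ {f : α → ℕ} (k : ℕ), Computable f → Computable fun x => f x == k :=
    fun k hf => Primrec.beq.to_comp.comp hf (Computable.const k)
  have hq1 := computable_fst_unpair hq
  have hq2 := computable_snd_unpair hq
  have hn1 := computable_fst_unpair hn
  have hn2 := computable_snd_unpair hn
  exact Partrec.cond (beq 0 he) (Computable.const 0).partrec <|
    Partrec.cond (beq 1 he) (Computable.succ.comp hn).partrec <|
    Partrec.cond (beq 2 he) hn1.partrec <|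
    Partrec.cond (beq 3 he) hn2.partrec <|
    Partrec.cond (beq 4 he) (hh.comp Computable.id hn) <|
    Partrec.cond (beq 0 hm) (partrec_pair_call hc hq1 hq2 hn) <|
    Partrec.cond (beq 1 hm) (partrec_comp_call hc hq1 hq2 hn) <|
    Partrec.cond (beq 2 hm) (partrec_prec_call hc hq1 hq2 hn1 hn2)
      (partrec_rfind_call hc hq hn)

end

/-- A machine that runs every program, with a partial oracle that depends on a parameter. -/
theorem exists_universal {h : ℕ → ℕ → Part ℕ} (hh : Partrec₂ h) :
    ∃ U : ℕ →. ℕ, Nat.Partrec U ∧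
      ∀ p c n, U (Nat.pair p (Nat.pair (encode c) n)) = evalPart (h p) c n := by
  have hstep : Partrec₂ fun (s : Code) (m : ℕ) =>
      step (h m.unpair.1) (fun a b => s.eval (Nat.pair m.unpair.1 (Nat.pair a b)))
        m.unpair.2.unpair.1 m.unpair.2.unpair.2 := by
    have hm : Computable fun x : Code × ℕ => x.2.unpair.1 := computable_fst_unpair Computable.snd
    have hm2 : Computable fun x : Code × ℕ => x.2.unpair.2 := computable_snd_unpair Computable.snd
    refine partrec_step (α := Code × ℕ) (h := fun x => h x.2.unpair.1)
      (call := fun x a b => x.1.eval (Nat.pair x.2.unpair.1 (Nat.pair a b)))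
      (hh.comp (hm.comp Computable.fst) Computable.snd) ?_
      (computable_fst_unpair hm2) (computable_snd_unpair hm2)
    exact Code.eval_part.comp (Computable.fst.comp Computable.fst)
      (computable_natPair (hm.comp Computable.fst)
        (computable_natPair (Computable.fst.comp Computable.snd)
          (Computable.snd.comp Computable.snd)))
  -- Kleene's recursion theorem: `s` is a code that uses itself as the `call` in `step`.
  obtain ⟨s, hs⟩ := Code.fixed_point₂ hstep
  have key : ∀ p e n, s.eval (Nat.pair p (Nat.pair e n)) =
      step (h p) (fun a b => s.eval (Nat.pair p (Nat.pair a b))) e n := by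
    intro p e n
    conv_lhs => rw [hs]
    simp only [Nat.unpair_pair]
  refine ⟨s.eval, Nat.Partrec.Code.exists_code.2 ⟨s, rfl⟩, fun p c => ?_⟩
  induction c with
  | zero | succ | left | right | oracle => intro n; rw [key]; rfl
  | pair c d ihc ihd =>
    intro n
    have e1 : 4 * Nat.pair c.encode d.encode + 5 - 5 = 4 * Nat.pair c.encode d.encode := by omega
    rw [key]
    simp [step, encode, e1, ihc, ihd, evalPart]
  | comp c d ihc ihd =>
    intro n
    have e1 : 4 * Nat.pair c.encode d.encode + 6 - 5 = 4 * Nat.pair c.encode d.encode + 1 := by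
      omega
    have e2 : (4 * Nat.pair c.encode d.encode + 1) / 4 = Nat.pair c.encode d.encode := by omega
    rw [key]
    simp [step, encode, e1, e2, ihc, ihd, evalPart, Nat.add_mod]
  | prec c d ihc ihd =>
    intro n
    have e1 : 4 * Nat.pair c.encode d.encode + 7 - 5 = 4 * Nat.pair c.encode d.encode + 2 := by
      omega
    have e2 : (4 * Nat.pair c.encode d.encode + 2) / 4 = Nat.pair c.encode d.encode := by omega
    rw [key]
    simp [step, encode, e1, e2, ihc, ihd, evalPart, Nat.add_mod]
  | rfind c ihc =>
    intro n
    have e1 : 4 * c.encode + 8 - 5 = 4 * c.encode + 3 := by omega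
    have e2 : (4 * c.encode + 3) / 4 = c.encode := by omega
    rw [key]
    simp [step, encode, e1, e2, ihc, evalPart, Nat.add_mod]

end OracleCode

/-! ### Enumerating `0'`, and Post's theorem for `0''` -/

open OracleCode (computable_natPair computable_fst_unpair computable_snd_unpair)

/-- The domain of a partial recursive function has a primitive recursive enumeration in stages. -/
theorem exists_stages_of_partrec {φ : ℕ →. ℕ} (hφ : Nat.Partrec φ) :
    ∃ K : ℕ → ℕ → Bool, Primrec₂ K ∧ (∀ n s t, s ≤ t → K n s = true → K n t = true) ∧
      ∀ n, (φ n).Dom ↔ ∃ s, K n s = true := by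
  obtain ⟨c, rfl⟩ := Nat.Partrec.Code.exists_code.1 hφ
  refine ⟨fun n s => (Nat.Partrec.Code.evaln s c n).isSome, ?_, ?_, fun n => ?_⟩
  · have : Primrec fun x : ℕ × ℕ => ((x.2, c), x.1) :=
      (Primrec.snd.pair (Primrec.const c)).pair Primrec.fst
    exact Primrec.option_isSome.comp (Nat.Partrec.Code.primrec_evaln.comp this)
  · intro n s t hst h
    obtain ⟨v, hv⟩ := Option.isSome_iff_exists.1 h
    exact Option.isSome_iff_exists.2 ⟨v, Nat.Partrec.Code.evaln_mono hst hv⟩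
  · rw [Part.dom_iff_mem]
    simp only [Nat.Partrec.Code.evaln_complete, Option.isSome_iff_exists, Option.mem_def]
    exact exists_comm

theorem mem_turingJump {A : Set ℕ} {c : OracleCode} :
    c.encode ∈ turingJump A ↔ (c.eval (charFun A) c.encode).Dom := by
  constructor
  · rintro ⟨d, hd, h⟩
    rwa [OracleCode.encode_injective hd] at h
  · exact fun h => ⟨c, rfl, h⟩

theorem charFun_empty : charFun ∅ = fun _ => 0 := by
  funext n; simp [charFun]

/-- `0'` is recursively enumerable. -/
theorem exists_stages_zeroJump :
    ∃ K : ℕ → ℕ → Bool, Primrec₂ K ∧ (∀ n s t, s ≤ t → K n s = true → K n t = true) ∧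
      ∀ n, n ∈ turingJump ∅ ↔ ∃ s, K n s = true := by
  obtain ⟨U, hU, hU'⟩ := OracleCode.exists_universal
    (h := fun _ n => Part.some (charFun ∅ n))
    (by rw [charFun_empty]; exact (Computable.const 0).partrec)
  have hφ : Nat.Partrec fun n => U (Nat.pair 0 (Nat.pair n n)) :=
    Partrec.nat_iff.1 ((Partrec.nat_iff.2 hU).comp
      (computable_natPair (Computable.const 0) (computable_natPair Computable.id Computable.id)))
  obtain ⟨K, h₁, h₂, h₃⟩ := exists_stages_of_partrec hφ
  refine ⟨K, h₁, h₂, fun n => ?_⟩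
  obtain ⟨c, rfl⟩ := OracleCode.encode_surjective n
  rw [← h₃, mem_turingJump, hU', OracleCode.evalPart_coe]

/-- Post's theorem for `0''`: it is a `Σ⁰₂` set. -/
theorem zeroDoubleJump_sigmaTwo :
    ∃ R : ℕ → ℕ → ℕ → Prop, PrimrecPred (fun x : ℕ × ℕ × ℕ => R x.1 x.2.1 x.2.2) ∧
      ∀ e, e ∈ turingJump (turingJump ∅) ↔ ∃ s, ∀ t, R e s t := by
  obtain ⟨K, hK, hKm, hKs⟩ := exists_stages_zeroJump
  -- The parameter codes (k, s): the oracle answers queries below k by the stage s approximation of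
  -- `0'` and diverges on all others.
  let h : ℕ → ℕ → Part ℕ := fun p n =>
    bif decide (n < p.unpair.1) then Part.some (K n p.unpair.2).toNat else Part.none
  have hh : Partrec₂ h := by
    refine Partrec.cond ?_ (Computable.partrec ?_) Partrec.none
    · exact Primrec.nat_lt.decide.to_comp.comp Computable.snd
        (computable_fst_unpair Computable.fst)
    · exact (Primrec.dom_bool Bool.toNat).to_comp.comp
        (hK.to_comp.comp Computable.snd (computable_snd_unpair Computable.fst))
  obtain ⟨U, hU, hU'⟩ := OracleCode.exists_universal hh
  obtain ⟨H, hH, hHm, hHs⟩ := exists_stages_of_partrec hU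
  -- The witness w codes ((k, s), r) and t codes (n, t'). Over all t, the first conjunct says that
  -- `0'` below k has settled by stage s; the second says that the computation with this finite
  -- oracle is seen to halt by stage r.
  refine ⟨fun e w t => (¬ (t.unpair.1 < w.unpair.1.unpair.1 ∧ K t.unpair.1 t.unpair.2 = true) ∨
      K t.unpair.1 w.unpair.1.unpair.2 = true) ∧
      H (Nat.pair w.unpair.1 (Nat.pair e e)) w.unpair.2 = true, ?_, fun e => ?_⟩
  · have hw : Primrec fun x : ℕ × ℕ × ℕ => x.2.1.unpair :=
      Primrec.unpair.comp (Primrec.fst.comp Primrec.snd)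
    have hp : Primrec fun x : ℕ × ℕ × ℕ => x.2.1.unpair.1.unpair :=
      Primrec.unpair.comp (Primrec.fst.comp hw)
    have ht : Primrec fun x : ℕ × ℕ × ℕ => x.2.2.unpair :=
      Primrec.unpair.comp (Primrec.snd.comp Primrec.snd)
    have e1 : PrimrecPred fun x : ℕ × ℕ × ℕ => x.2.2.unpair.1 < x.2.1.unpair.1.unpair.1 :=
      Primrec.nat_lt.comp (Primrec.fst.comp ht) (Primrec.fst.comp hp)
    have e2 : PrimrecPred fun x : ℕ × ℕ × ℕ => K x.2.2.unpair.1 x.2.2.unpair.2 = true :=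
      Primrec.eq.comp (hK.comp (Primrec.fst.comp ht) (Primrec.snd.comp ht)) (Primrec.const true)
    have e3 : PrimrecPred fun x : ℕ × ℕ × ℕ => K x.2.2.unpair.1 x.2.1.unpair.1.unpair.2 = true :=
      Primrec.eq.comp (hK.comp (Primrec.fst.comp ht) (Primrec.snd.comp hp)) (Primrec.const true)
    have e4 : PrimrecPred fun x : ℕ × ℕ × ℕ =>
        H (Nat.pair x.2.1.unpair.1 (Nat.pair x.1 x.1)) x.2.1.unpair.2 = true :=
      Primrec.eq.comp (hH.comp (Primrec₂.natPair.comp (Primrec.fst.comp hw)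
        (Primrec₂.natPair.comp Primrec.fst Primrec.fst)) (Primrec.snd.comp hw)) (Primrec.const true)
    exact (((e1.and e2).not).or e3).and e4
  · obtain ⟨c, rfl⟩ := OracleCode.encode_surjective e
    have correct : ∀ k s, (∀ n < k, ∀ t, K n t = true → K n s = true) → ∀ n,
        h (Nat.pair k s) n = if n < k then Part.some (charFun (turingJump ∅) n) else Part.none := by
      intro k s hks n
      simp only [h, Nat.unpair_pair]
      by_cases hn : n < k
      · simp only [hn, decide_true, cond_true, if_true, charFun]
        by_cases hs : K n s = true
        · rw [if_pos ((hKs n).2 ⟨s, hs⟩), hs]; rfl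
        · rw [if_neg fun hm => hs ((hKs n).1 hm |>.elim (hks n hn)), Bool.eq_false_iff.2 hs]; rfl
      · simp [hn]
    rw [mem_turingJump, ← OracleCode.evalPart_coe]
    constructor
    · intro hd
      -- The use principle: by continuity a halting computation needs only the part of the oracle
      -- below some k.
      obtain ⟨v, hv⟩ := Part.dom_iff_mem.1 hd
      obtain ⟨k, hk⟩ := (OracleCode.evalPart_eventually (h := fun k n =>
        if n < k then Part.some (charFun (turingJump ∅) n) else Part.none) (fun n v hv => by
          filter_upwards [Filter.eventually_gt_atTop n] with k hk
          rwa [if_pos hk]) c _ v hv).exists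
      obtain ⟨s, hs⟩ : ∃ s, ∀ n < k, ∀ t, K n t = true → K n s = true := by
        have : ∀ᶠ s in Filter.atTop, ∀ n ∈ Set.Iio k, ∀ t, K n t = true → K n s = true := by
          rw [Filter.eventually_all_finite (Set.finite_Iio k)]
          intro n _
          by_cases hn : ∃ t, K n t = true
          · obtain ⟨t, ht⟩ := hn
            filter_upwards [Filter.eventually_ge_atTop t] with s hs _ _
            exact hKm n t s hs ht
          · exact Filter.Eventually.of_forall fun s t ht => absurd ⟨t, ht⟩ hn
        exact this.exists
      rw [← funext (correct k s hs), ← hU'] at hk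
      obtain ⟨r, hr⟩ := (hHs _).1 (Part.dom_iff_mem.2 ⟨v, hk⟩)
      refine ⟨Nat.pair (Nat.pair k s) r, fun t => ?_⟩
      simp only [Nat.unpair_pair]
      refine ⟨?_, hr⟩
      by_cases ht : t.unpair.1 < k ∧ K t.unpair.1 t.unpair.2 = true
      · exact Or.inr (hs _ ht.1 _ ht.2)
      · exact Or.inl ht
    · rintro ⟨w, hw⟩
      have hd := (hHs _).2 ⟨_, (hw 0).2⟩
      rw [hU'] at hd
      obtain ⟨v, hv⟩ := Part.dom_iff_mem.1 hd
      refine Part.dom_iff_mem.2 ⟨v, OracleCode.evalPart_mono (fun n u hu => ?_) c _ v hv⟩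
      have := correct w.unpair.1.unpair.1 w.unpair.1.unpair.2 (fun n hn t ht => by
        have := (hw (Nat.pair n t)).1
        simp only [Nat.unpair_pair] at this
        exact this.resolve_left (not_not.2 ⟨hn, ht⟩)) n
      rw [Nat.pair_unpair] at this
      rw [this] at hu
      split_ifs at hu with hn
      · exact hu
      · exact absurd hu (Part.notMem_none _)

/-- Every recursively enumerable set is many-one reducible to `0'`. -/
theorem REPred.exists_manyOne_zeroJump {α : Type} [Primcodable α] {P : α → Prop} (hP : REPred P) :
    ∃ q : α → ℕ, Computable q ∧ ∀ a, P a ↔ q a ∈ turingJump ∅ := by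
  have hφ : Partrec fun n : ℕ => ((Encodable.decode (α := α) n : Part α).bind fun a =>
      (Part.assert (P a) fun _ => Part.some ())).map fun _ => 0 := by
    refine Partrec.map (Partrec.bind (Computable.ofOption Computable.decode)
      (hP.comp Computable.snd)) (Computable.const 0).to₂
  obtain ⟨c, hc⟩ := (OracleCode.exists_code (charFun ∅) _).1 hφ.turingReducible
  -- The s-m-n construction: composing `c` with a constant program gives a program that ignores its
  -- input, so its halting on its own code expresses `P a`.
  let const : ℕ → OracleCode := fun n => n.rec .zero fun _ c => .comp .succ c
  have hconst : ∀ g n m, (const n).eval g m = Part.some n := by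
    intro g n m
    induction n with
    | zero => rfl
    | succ n ih =>
      change (const n).eval g m >>= OracleCode.succ.eval g = _
      rw [ih]
      exact Part.bind_some _ _
  refine ⟨fun a => (OracleCode.comp c (const (Encodable.encode a))).encode, ?_, fun a => ?_⟩
  · have : Primrec fun n => (const n).encode := by
      refine (Primrec.nat_rec₁ (f := fun _ i => 4 * Nat.pair 1 i + 6) 0 ?_).of_eq fun n => ?_
      · exact Primrec.nat_add.comp (Primrec.nat_mul.comp (Primrec.const 4)
          (Primrec₂.natPair.comp (Primrec.const 1) Primrec.snd)) (Primrec.const 6)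
      · induction n with
        | zero => rfl
        | succ n ih => simp only [ih]; rfl
    exact ((Primrec.nat_add.comp (Primrec.nat_mul.comp (Primrec.const 4)
      (Primrec₂.natPair.comp (Primrec.const c.encode) this)) (Primrec.const 6)).comp
        Primrec.encode).to_comp
  · rw [mem_turingJump]
    change P a ↔ ((const (Encodable.encode a)).eval (charFun ∅) _ >>= c.eval (charFun ∅)).Dom
    rw [hconst, hc]
    change _ ↔ ((Part.some (Encodable.encode a)).bind _).Dom
    rw [Part.bind_some]
    simp only [Encodable.encodek, Part.coe_some, Part.bind_some]
    exact ⟨fun h => ⟨h, trivial⟩, fun ⟨h, _⟩ => h⟩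

/-! ### Closure properties of Turing reducibility for total functions -/

namespace TuringReducible

variable {f h : ℕ → ℕ} {g : ℕ →. ℕ}

theorem of_computable (hf : Computable f) : (f : ℕ →. ℕ) ≤ᵀ g := Partrec.turingReducible hf

theorem comp_total (hf : (f : ℕ →. ℕ) ≤ᵀ g) (hh : (h : ℕ →. ℕ) ≤ᵀ g) :
    ((fun n => f (h n) : ℕ → ℕ) : ℕ →. ℕ) ≤ᵀ g := by
  rw [TuringReducible, RecursiveIn.iff_nat] at *
  exact (Nat.RecursiveIn.comp hf hh).of_eq fun n => Part.bind_some _ _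

theorem pair_total (hf : (f : ℕ →. ℕ) ≤ᵀ g) (hh : (h : ℕ →. ℕ) ≤ᵀ g) :
    ((fun n => Nat.pair (f n) (h n) : ℕ → ℕ) : ℕ →. ℕ) ≤ᵀ g := by
  rw [TuringReducible, RecursiveIn.iff_nat] at *
  refine (Nat.RecursiveIn.pair hf hh).of_eq fun n => ?_
  simp [Seq.seq]

/-- A computable function of two values that are computed from the oracle. -/
theorem computable₂_total {k : ℕ → ℕ → ℕ} (hk : Computable₂ k) (hf : (f : ℕ →. ℕ) ≤ᵀ g)
    (hh : (h : ℕ →. ℕ) ≤ᵀ g) : ((fun n => k (f n) (h n) : ℕ → ℕ) : ℕ →. ℕ) ≤ᵀ g := by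
  have : Computable fun p : ℕ => k p.unpair.1 p.unpair.2 :=
    hk.comp (computable_fst_unpair Computable.id) (computable_snd_unpair Computable.id)
  simpa using comp_total (of_computable this) (pair_total hf hh)

/-- Iteration of a function that is computed from the oracle. -/
theorem nat_rec_total {k : ℕ → ℕ → ℕ} (a : ℕ)
    (hk : ((fun p => k p.unpair.1 p.unpair.2 : ℕ → ℕ) : ℕ →. ℕ) ≤ᵀ g) :
    ((fun n => n.rec a k : ℕ → ℕ) : ℕ →. ℕ) ≤ᵀ g := by
  have h₀ : ((fun _ => a : ℕ → ℕ) : ℕ →. ℕ) ≤ᵀ g := of_computable (Computable.const a)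
  have h₁ : ((fun p => k p.unpair.2.unpair.1 p.unpair.2.unpair.2 : ℕ → ℕ) : ℕ →. ℕ) ≤ᵀ g :=
    comp_total (f := fun p => k p.unpair.1 p.unpair.2) (h := fun p => p.unpair.2) hk
      (of_computable (computable_snd_unpair Computable.id))
  -- Primitive recursion expects a parameter; 0 is a dummy.
  have h₂ : ((fun n => Nat.pair 0 n : ℕ → ℕ) : ℕ →. ℕ) ≤ᵀ g :=
    of_computable (computable_natPair (Computable.const 0) Computable.id)
  rw [TuringReducible, RecursiveIn.iff_nat] at *
  refine (Nat.RecursiveIn.comp (Nat.RecursiveIn.prec h₀ h₁) h₂).of_eq fun n => ?_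
  refine (Part.bind_some _ _).trans ?_
  simp only [Nat.unpair_pair]
  induction n with
  | zero => rfl
  | succ n ih =>
    simp only [ih]
    refine (Part.bind_some _ _).trans ?_
    simp

/-- Unbounded search. -/
theorem exists_search_total (hf : (f : ℕ →. ℕ) ≤ᵀ g) (H : ∀ a, ∃ n, f (Nat.pair a n) = 0) :
    ∃ k : ℕ → ℕ, (k : ℕ →. ℕ) ≤ᵀ g ∧ ∀ a, f (Nat.pair a (k a)) = 0 := by
  refine ⟨fun a => Nat.find (H a), ?_, fun a => Nat.find_spec (H a)⟩
  rw [TuringReducible, RecursiveIn.iff_nat] at *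
  refine (Nat.RecursiveIn.rfind hf).of_eq fun a => ?_
  refine Part.eq_some_iff.2 (Nat.mem_rfind.2 ⟨?_, fun {m} hm => ?_⟩)
  · simpa using Nat.find_spec (H a)
  · simpa using Nat.find_min (H a) hm

theorem zeroJump_join (d : ℕ → ℕ) : (zeroJump : ℕ →. ℕ) ≤ᵀ (turingJoin zeroJump d : ℕ →. ℕ) := by
  have := comp_total (TuringReducible.refl (turingJoin zeroJump d : ℕ →. ℕ))
    (of_computable (f := fun n => 2 * n) Primrec.nat_double.to_comp)
  simpa [turingJoin] using this

theorem right_join (d : ℕ → ℕ) : (d : ℕ →. ℕ) ≤ᵀ (turingJoin zeroJump d : ℕ →. ℕ) := by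
  have := comp_total (TuringReducible.refl (turingJoin zeroJump d : ℕ →. ℕ))
    (of_computable (f := fun n => 2 * n + 1) Primrec.nat_double_succ.to_comp)
  have e : ∀ n, (2 * n + 1) / 2 = n := by omega
  simpa [turingJoin, e, Nat.add_mod] using this

theorem join_le (hf : (f : ℕ →. ℕ) ≤ᵀ g) (hh : (h : ℕ →. ℕ) ≤ᵀ g) :
    (turingJoin f h : ℕ →. ℕ) ≤ᵀ g := by
  have hd : ((fun n => n / 2 : ℕ → ℕ) : ℕ →. ℕ) ≤ᵀ g := of_computable
    (Primrec.nat_div.to_comp.comp Computable.id (Computable.const 2))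
  have hsel : Computable₂ fun a b : ℕ => if a % 2 = 0 then b.unpair.1 else b.unpair.2 :=
    (Primrec.ite (Primrec.eq.comp (Primrec.nat_mod.comp Primrec.fst (Primrec.const 2))
      (Primrec.const 0)) (Primrec.fst.comp (Primrec.unpair.comp Primrec.snd))
      (Primrec.snd.comp (Primrec.unpair.comp Primrec.snd))).to_comp
  have := computable₂_total hsel (of_computable Computable.id)
    (pair_total (comp_total hf hd) (comp_total hh hd))
  have e : turingJoin f h = fun n => if n % 2 = 0 then f (n / 2) else h (n / 2) := rfl
  rw [e]
  simpa using this

end TuringReducible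

open TuringReducible

/-! ### Questions that `0'` can answer -/

theorem ComputablePred.comp_computable {α β : Type*} [Primcodable α] [Primcodable β]
    {p : β → Prop} (hp : ComputablePred p) {f : α → β} (hf : Computable f) :
    ComputablePred fun a => p (f a) := by
  obtain ⟨_, h⟩ := hp
  exact ⟨fun a => inferInstance, h.comp hf⟩

/-- `0'` decides universal statements. -/
theorem exists_zeroJump_decides {P : ℕ → ℕ → Prop}
    (hP : ComputablePred fun x : ℕ × ℕ => P x.1 x.2) :
    ∃ q : ℕ → ℕ, (q : ℕ →. ℕ) ≤ᵀ (zeroJump : ℕ →. ℕ) ∧ ∀ a, q a = 0 ↔ ∀ t, P a t := by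
  classical
  have hre : REPred fun a => ¬ ∀ t, P a t := by
    have hfind : Partrec fun a => Nat.rfind fun t => Part.some (decide ¬ P a t) :=
      Partrec.rfind (p := fun a t => Part.some (decide ¬ P a t)) (hP.not.decide).partrec
    refine hfind.dom_re.of_eq fun a => ?_
    refine Nat.rfind_dom'.trans ?_
    simp
  obtain ⟨q, hq, hq'⟩ := hre.exists_manyOne_zeroJump
  refine ⟨fun a => zeroJump (q a), comp_total (TuringReducible.refl _) (of_computable hq),
    fun a => ?_⟩
  simp only [zeroJump, charFun, ite_eq_right_iff, one_ne_zero, imp_false, ← hq' a, not_not]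

/-- `0'` finds witnesses of `Σ⁰₂` statements. -/
theorem exists_zeroJump_witness {P : ℕ → ℕ → ℕ → Prop}
    (hP : ComputablePred fun x : ℕ × ℕ × ℕ => P x.1 x.2.1 x.2.2) (H : ∀ a, ∃ m, ∀ t, P a m t) :
    ∃ k : ℕ → ℕ, (k : ℕ →. ℕ) ≤ᵀ (zeroJump : ℕ →. ℕ) ∧ ∀ a t, P a (k a) t := by
  have : ComputablePred fun x : ℕ × ℕ => P x.1.unpair.1 x.1.unpair.2 x.2 :=
    hP.comp_computable ((computable_fst_unpair Computable.fst).pair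
      ((computable_snd_unpair Computable.fst).pair Computable.snd))
  obtain ⟨q, hq, hq'⟩ := exists_zeroJump_decides
    (P := fun a t => P a.unpair.1 a.unpair.2 t) this
  obtain ⟨k, hk, hk'⟩ := exists_search_total hq fun a => by
    obtain ⟨m, hm⟩ := H a
    exact ⟨m, (hq' _).2 (by simpa using hm)⟩
  refine ⟨k, hk, fun a t => ?_⟩
  simpa using (hq' _).1 (hk' a) t

/-- The jump of a set is not reducible to the set. -/
theorem not_turingJump_le (A : Set ℕ) :
    ¬ (charFun (turingJump A) : ℕ →. ℕ) ≤ᵀ (charFun A : ℕ →. ℕ) := by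
  intro h
  -- The diagonal program: it halts on n exactly when n is not in the jump. Running it on its own
  -- code gives the contradiction.
  have h₁ : (fun n => Nat.rfind fun _ => Part.some (decide (charFun (turingJump A) n = 0)) :
      ℕ →. ℕ) ≤ᵀ (charFun A : ℕ →. ℕ) := by
    have := comp_total h (of_computable (f := fun p => p.unpair.1)
      (computable_fst_unpair Computable.id))
    rw [TuringReducible, RecursiveIn.iff_nat] at *
    refine (Nat.RecursiveIn.rfind this).of_eq fun n => ?_
    simp [Part.map_id']
  obtain ⟨c, hc⟩ := (OracleCode.exists_code _ _).1 h₁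
  have h₂ := mem_turingJump (A := A) (c := c)
  rw [hc] at h₂
  replace h₂ := h₂.trans Nat.rfind_dom'
  by_cases hm : c.encode ∈ turingJump A
  · obtain ⟨n, hn, -⟩ := h₂.1 hm
    simp [charFun, hm] at hn
  · exact hm (h₂.2 ⟨0, by simp [charFun, hm], by simp⟩)

/-! ### Trees of binary strings with guarded right turns -/

/-- A binary string is guarded by `C` if a right turn at level `i` occurs only in strings of a
length `n` such that `C i x` for all `x < n`. -/
def IsGuarded (C : ℕ → ℕ → Prop) (l : List ℕ) : Prop :=
  ∀ i a, l[i]? = some a → a ≤ 1 ∧ (a = 1 → ∀ x < l.length, C i x)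

/-- The right turns of a binary string are at levels `i` with `∀ x, C i x`. -/
def IsLive (C : ℕ → ℕ → Prop) (l : List ℕ) : Prop :=
  ∀ i a, l[i]? = some a → a ≤ 1 ∧ (a = 1 → ∀ x, C i x)

/-- The tree of guarded binary strings. -/
def GuardedTree (C : ℕ → ℕ → Prop) : Type := {l : List ℕ // IsGuarded C l}

theorem List.exists_getElem?_ne {α : Type*} : ∀ {l m : List α}, ¬ l <+: m → ¬ m <+: l →
    ∃ (i : ℕ) (a b : α), l[i]? = some a ∧ m[i]? = some b ∧ a ≠ b
  | [], _, h, _ => absurd List.nil_prefix h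
  | _ :: _, [], _, h => absurd List.nil_prefix h
  | a :: l, b :: m, h, h' => by
    by_cases hab : a = b
    · subst hab
      simp only [List.cons_prefix_cons, true_and] at h h'
      obtain ⟨i, c, d, hc, hd, hcd⟩ := List.exists_getElem?_ne h h'
      exact ⟨i + 1, c, d, by simpa using hc, by simpa using hd, hcd⟩
    · exact ⟨0, a, b, rfl, rfl, hab⟩

theorem List.IsPrefix.getElem?_eq_of_lt {α : Type*} {l m : List α} (h : l <+: m) {i : ℕ}
    (hi : i < l.length) : l[i]? = m[i]? := by
  obtain ⟨k, rfl⟩ := h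
  rw [List.getElem?_append_left hi]

section

variable {C : ℕ → ℕ → Prop} {l m : List ℕ}

/-- The guard on a right turn only gets stricter as the string grows, so guarded strings are closed
under prefixes. -/
theorem IsGuarded.of_prefix (hm : IsGuarded C m) (h : l <+: m) : IsGuarded C l := by
  intro i a hi
  have hlt : i < l.length := (List.getElem?_eq_some_iff.1 hi).1
  rw [h.getElem?_eq_of_lt hlt] at hi
  exact ⟨(hm i a hi).1, fun ha x hx => (hm i a hi).2 ha x (hx.trans_le h.length_le)⟩

theorem IsLive.of_prefix (hm : IsLive C m) (h : l <+: m) : IsLive C l := by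
  intro i a hi
  rw [h.getElem?_eq_of_lt (List.getElem?_eq_some_iff.1 hi).1] at hi
  exact hm i a hi

theorem IsLive.isGuarded (h : IsLive C l) : IsGuarded C l := fun i a hi =>
  ⟨(h i a hi).1, fun ha x _ => (h i a hi).2 ha x⟩

theorem isLive_nil : IsLive C [] := fun i a h => by simp at h

theorem IsLive.concat (h : IsLive C l) {a : ℕ} (ha : a ≤ 1) (ha' : a = 1 → ∀ x, C l.length x) :
    IsLive C (l ++ [a]) := by
  intro i b hb
  rcases lt_trichotomy i l.length with hi | rfl | hi
  · rw [List.getElem?_append_left hi] at hb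
    exact h i b hb
  · obtain rfl : a = b := by simpa using hb
    exact ⟨ha, ha'⟩
  · rw [List.getElem?_eq_none (by simpa using hi)] at hb
    cases hb

/-- Left turns are never restricted, so a live string extends to every greater length. -/
theorem IsLive.append_zeros (h : IsLive C l) (k : ℕ) : IsLive C (l ++ List.replicate k 0) := by
  induction k with
  | zero => simpa using h
  | succ k ih =>
    rw [List.replicate_succ', ← List.append_assoc]
    exact ih.concat (Nat.zero_le _) (fun h => absurd h (by norm_num))

end

/-! ### The order and the infinite part of the guarded tree -/

namespace GuardedTree

variable {C : ℕ → ℕ → Prop}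

instance : PartialOrder (GuardedTree C) where
  le s t := s.1 <+: t.1
  le_refl s := List.prefix_refl s.1
  le_trans _ _ _ h h' := List.IsPrefix.trans h h'
  le_antisymm s t h h' := Subtype.ext (h.eq_of_length (h.length_le.antisymm h'.length_le))

/-- The level of a node is its length. -/
def level (s : GuardedTree C) : ℕ := s.1.length

/-- The predecessor of `s` at level `n`. -/
def restrict (s : GuardedTree C) (n : ℕ) : GuardedTree C :=
  ⟨s.1.take n, s.2.of_prefix (List.take_prefix _ _)⟩

theorem restrict_le (s : GuardedTree C) (n : ℕ) : s.restrict n ≤ s := List.take_prefix _ _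

theorem level_restrict {s : GuardedTree C} {n : ℕ} (h : n ≤ s.level) : (s.restrict n).level = n := by
  simpa [level, restrict] using h

theorem level_mono {s t : GuardedTree C} (h : s ≤ t) : s.level ≤ t.level :=
  List.IsPrefix.length_le h

theorem eq_of_le_of_level_le {s t : GuardedTree C} (h : s ≤ t) (h' : t.level ≤ s.level) : s = t :=
  Subtype.ext (List.IsPrefix.eq_of_length h (h'.antisymm' (level_mono h)))

theorem level_strictMono {s t : GuardedTree C} (h : s < t) : s.level < t.level :=
  lt_of_not_ge fun h' => h.ne (eq_of_le_of_level_le h.le h')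

theorem le_of_le_of_level_le {s t u : GuardedTree C} (hs : s ≤ u) (ht : t ≤ u)
    (h : s.level ≤ t.level) : s ≤ t := List.prefix_of_prefix_length_le hs ht h

theorem eq_restrict {s t : GuardedTree C} (h : s ≤ t) : s = t.restrict s.level :=
  eq_of_le_of_level_le (le_of_le_of_level_le h (t.restrict_le _) (level_restrict (level_mono h)).ge)
    (level_restrict (level_mono h)).le

/-- This expresses the level by the order alone, so that it can be read off in every isomorphic
copy. -/
theorem ncard_lt (s : GuardedTree C) : {t | t < s}.ncard = s.level := by
  have : {t | t < s} = s.restrict '' (Finset.range s.level : Set ℕ) := by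
    ext t
    simp only [Set.mem_ofPred_eq, Set.mem_image, Finset.coe_range, Set.mem_Iio]
    constructor
    · exact fun h => ⟨t.level, level_strictMono h, (eq_restrict h.le).symm⟩
    · rintro ⟨n, hn, rfl⟩
      refine lt_of_le_of_ne (s.restrict_le n) fun h => ?_
      have := level_restrict hn.le
      rw [h] at this
      omega
  rw [this, Set.InjOn.ncard_image, Set.ncard_coe_finset, Finset.card_range]
  intro i hi j hj hij
  rw [← level_restrict (Finset.mem_range.1 hi).le, hij, level_restrict (Finset.mem_range.1 hj).le]

theorem finite_level_le (n : ℕ) : {s : GuardedTree C | s.level ≤ n}.Finite := by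
  have h : ((fun l : List (Fin 2) => l.map Fin.val) '' {l | l.length ≤ n}).Finite :=
    (List.finite_length_le (Fin 2) n).image _
  refine Set.Finite.of_finite_image (f := Subtype.val) (h.subset ?_) Subtype.val_injective.injOn
  rintro _ ⟨s, hs, rfl⟩
  refine ⟨s.1.map (Fin.ofNat 2), by simpa [level] using hs, ?_⟩
  change (s.1.map (Fin.ofNat 2)).map Fin.val = s.1
  rw [List.map_map]
  refine (List.map_congr_left fun a ha => ?_).trans (List.map_id _)
  obtain ⟨i, hi⟩ := List.mem_iff_getElem?.1 ha
  have := (s.2 i a hi).1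
  simp only [Function.comp_apply, Fin.val_ofNat, id_eq]
  omega

theorem isTree : IsTree (GuardedTree C) where
  exists_root := ⟨⟨[], isLive_nil.isGuarded⟩, fun _ => List.nil_prefix⟩
  finite_below s := (finite_level_le s.level).subset fun _ h => level_mono h
  chain_below s := by
    intro t ht u hu _
    rcases le_total t.level u.level with h | h
    · exact Or.inl (le_of_le_of_level_le ht hu h)
    · exact Or.inr (le_of_le_of_level_le hu ht h)

/-- The node given by a live string. -/
def ofLive {l : List ℕ} (h : IsLive C l) : GuardedTree C := ⟨l, h.isGuarded⟩

/-- A live node followed by `k` left turns. -/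
def zeros {s : GuardedTree C} (h : IsLive C s.1) (k : ℕ) : GuardedTree C :=
  ofLive (h.append_zeros k)

theorem le_zeros {s : GuardedTree C} (h : IsLive C s.1) (k : ℕ) : s ≤ zeros h k :=
  List.prefix_append _ _

theorem level_zeros {s : GuardedTree C} (h : IsLive C s.1) (k : ℕ) :
    (zeros h k).level = s.level + k := by
  simp [zeros, ofLive, level]

theorem zeros_mono {s : GuardedTree C} (h : IsLive C s.1) : Monotone (zeros h) := by
  intro i j hij
  obtain ⟨k, rfl⟩ := Nat.exists_eq_add_of_le hij
  exact ⟨List.replicate k 0, by simp [zeros, ofLive]⟩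

theorem zeros_injective {s : GuardedTree C} (h : IsLive C s.1) : Function.Injective (zeros h) := by
  intro i j hij
  have := congrArg level hij
  rw [level_zeros, level_zeros] at this
  omega

/-- If `C i x` fails for a right turn of `s` at level i, every extension of `s` has length at most
x, and there are only finitely many such strings. A live string has all its extensions by left turns
above it. -/
theorem isInfiniteNode_iff {s : GuardedTree C} : IsInfiniteNode s ↔ IsLive C s.1 := by
  constructor
  · intro hs i a hi
    refine ⟨(s.2 i a hi).1, fun ha x => by_contra fun hx => hs ?_⟩
    refine (finite_level_le x).subset fun t ht => ?_
    by_contra hlt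
    have hit : t.1[i]? = some a := by
      rwa [← List.IsPrefix.getElem?_eq_of_lt ht (List.getElem?_eq_some_iff.1 hi).1]
    exact hx ((t.2 i a hit).2 ha x (not_le.1 hlt))
  · intro h
    exact (Set.infinite_range_of_injective (zeros_injective h)).mono
      (by rintro _ ⟨k, rfl⟩; exact le_zeros h k)

theorem exists_isTreePath {s : GuardedTree C} (h : IsLive C s.1) :
    ∃ P : Set (GuardedTree C), IsTreePath P ∧ s ∈ P := by
  have hc : IsChain (· ≤ ·) (Set.range (zeros h)) := (zeros_mono h).isChain_range
  obtain ⟨P, hP, hsub⟩ := hc.exists_maxChain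
  refine ⟨P, ⟨(Set.infinite_range_of_injective (zeros_injective h)).mono hsub, hP⟩, hsub ⟨0, ?_⟩⟩
  exact Subtype.ext (by simp [zeros, ofLive])

theorem IsTreePath.exists_level_gt {P : Set (GuardedTree C)} (hP : IsTreePath P) (n : ℕ) :
    ∃ s ∈ P, n < s.level := by
  by_contra! h
  exact hP.1 ((finite_level_le n).subset h)

theorem IsTreePath.isLive {P : Set (GuardedTree C)} (hP : IsTreePath P) {s : GuardedTree C}
    (hs : s ∈ P) : IsLive C s.1 := by
  refine isInfiniteNode_iff.1 fun hfin => hP.1 ?_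
  refine (hfin.union (isTree.finite_below s)).subset fun t ht => ?_
  rcases hP.2.1.total hs ht with h | h
  exacts [Or.inl h, Or.inr h]

/-- A live node is never maximal, as it has a live left successor. A path is never isolated:
reversing its turn at a high level b with `∀ x, C b x` gives another live node. -/
theorem isTypeThree (hC : {i | ∀ x, C i x}.Infinite) : IsTypeThree (GuardedTree C) where
  infinite := Set.infinite_univ_iff.1
    ((isInfiniteNode_iff (s := ofLive (C := C) isLive_nil)).2 isLive_nil |>.mono (Set.subset_univ _))
  no_maximal_infinite_node s := by
    rintro ⟨h, h'⟩
    rw [isInfiniteNode_iff] at h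
    refine h' (zeros h 1) (lt_of_le_of_ne (le_zeros h 1) fun e => ?_)
      (isInfiniteNode_iff.2 (h.append_zeros 1))
    have := level_zeros h 1
    rw [← e] at this
    omega
  no_isolated_path P := by
    rintro ⟨hP, s, hs, hu⟩
    obtain ⟨b, hb, hsb⟩ := hC.exists_gt s.level
    obtain ⟨p, hp, hbp⟩ := IsTreePath.exists_level_gt hP b
    have hpl := IsTreePath.isLive hP hp
    have hsp : s ≤ p := by
      rcases hP.2.1.total hs hp with h | h
      · exact h
      · have := level_mono h
        omega
    have hlen : (p.1.take b).length = b := level_restrict (s := p) hbp.le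
    -- The last turn is opposite to the one that `P` takes at level b; either turn is live there.
    have hq : IsLive C (p.1.take b ++ [1 - p.1[b]]) :=
      (hpl.of_prefix (List.take_prefix _ _)).concat (Nat.sub_le _ _) fun _ => hlen.symm ▸ hb
    obtain ⟨Q, hQ, hqQ⟩ := exists_isTreePath (s := ofLive hq) hq
    have hsq : s ≤ ofLive hq := by
      refine le_trans (b := p.restrict b) ?_ (List.prefix_append _ _)
      exact le_of_le_of_level_le hsp (p.restrict_le b) (by rw [level_restrict hbp.le]; exact hsb.le)
    have hsQ : s ∈ Q := by
      by_contra hn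
      refine hn ?_
      have := hQ.2.2 (t := insert s Q) (hQ.2.1.insert fun t ht _ => ?_) (Set.subset_insert _ _)
      · rw [this]; exact Set.mem_insert _ _
      · rcases hQ.2.1.total ht hqQ with h | h
        · exact (isTree.chain_below (ofLive hq)).total hsq h
        · exact Or.inl (hsq.trans h)
    have hpq : ofLive hq ≤ p := by
      rw [hu Q hQ hsQ] at hqQ
      have hl : (ofLive hq).level = b + 1 := by simp [ofLive, level, hlen]
      rcases hP.2.1.total hqQ hp with h | h
      · exact h
      · exact (eq_of_le_of_level_le h (by rw [hl]; exact hbp)).ge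
    have h1 : (ofLive hq).1[b]? = some (1 - p.1[b]) := by
      simp [ofLive, hlen]
    rw [hpq.getElem?_eq_of_lt (by simp [ofLive, hlen]), List.getElem?_eq_getElem hbp] at h1
    have := Option.some.inj h1
    omega

/-! ### How self-embeddings move levels -/

section Embedding

variable (δ : GuardedTree C ↪o GuardedTree C)

/-- Each of the k steps from `s` up to `t` raises the level of the image by at least one. -/
theorem level_add_le {s : GuardedTree C} : ∀ (k : ℕ) {t : GuardedTree C}, s ≤ t →
    t.level = s.level + k → (δ s).level + k ≤ (δ t).level
  | 0, _, h, _ => level_mono (δ.monotone h)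
  | k + 1, t, h, hk => by
    have hl : (t.restrict (s.level + k)).level = s.level + k := level_restrict (by omega)
    have := level_add_le k (le_of_le_of_level_le h (t.restrict_le (s.level + k)) (by omega)) hl
    have hlt : t.restrict (s.level + k) < t := lt_of_le_of_ne (t.restrict_le _) fun e => by
      rw [e] at hl; omega
    have := level_strictMono (δ.strictMono hlt)
    omega

theorem level_le_level_apply (s : GuardedTree C) : s.level ≤ (δ s).level := by
  have := level_add_le δ s.level (s := s.restrict 0) (s.restrict_le 0)
    (by rw [level_restrict (Nat.zero_le _)]; omega)
  omega

theorem isLive_apply {s : GuardedTree C} (h : IsLive C s.1) : IsLive C (δ s).1 := by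
  rw [← isInfiniteNode_iff] at h ⊢
  refine (h.image δ.injective.injOn).mono ?_
  rintro _ ⟨t, ht, rfl⟩
  exact δ.monotone ht

/-- An injective self-map of a finite set is onto. -/
theorem _root_.Set.Finite.exists_of_mapsTo {α : Type*} {K : Set α} (hK : K.Finite) {f : α → α}
    (hf : Function.Injective f) (hm : ∀ x ∈ K, f x ∈ K) {y : α} (hy : y ∈ K) : ∃ x ∈ K, f x = y := by
  have : f '' K = K := Set.eq_of_subset_of_ncard_le (Set.image_subset_iff.2 hm)
    (Set.ncard_image_of_injective K hf).ge hK
  rwa [← this] at hy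

/-- If all live nodes keep their levels, `δ` permutes the finite set of live nodes of each level. It
then also permutes the finite set of nodes with no live node of level n at or below them, and every
node lies in such a set. -/
theorem exists_isLive_level_lt (hδ : ¬ Function.Surjective δ) :
    ∃ s : GuardedTree C, IsLive C s.1 ∧ s.level < (δ s).level := by
  by_contra! H
  have hl : ∀ s : GuardedTree C, IsLive C s.1 → (δ s).level = s.level := fun s hs =>
    (H s hs).antisymm (level_le_level_apply δ s)
  refine hδ fun z => ?_
  set n := z.level + 1
  -- Such a node has level at most n or lies above one of the finitely many dead nodes of level n,
  -- each of which has finitely many nodes above it.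
  have hK : {z : GuardedTree C | ∀ r ≤ z, IsLive C r.1 → r.level ≠ n}.Finite := by
    have hD : (⋃ c ∈ {c : GuardedTree C | c.level ≤ n ∧ ¬ IsLive C c.1}, {t | c ≤ t}).Finite := by
      refine ((finite_level_le n).subset fun _ h => h.1).biUnion fun c hc => ?_
      exact not_not.1 fun h => hc.2 (isInfiniteNode_iff.1 h)
    refine ((finite_level_le n).union hD).subset fun t ht => ?_
    by_cases htn : t.level ≤ n
    · exact Or.inl htn
    · have hr := level_restrict (not_le.1 htn).le
      exact Or.inr (Set.mem_biUnion (x := t.restrict n)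
        ⟨hr.le, fun h => ht _ (t.restrict_le n) h hr⟩ (t.restrict_le n))
  -- A live node of level n below `δ t` is `δ r'` for some live `r'` of level n, and then `r' ≤ t`
  -- because `δ` reflects the order.
  obtain ⟨y, -, hy⟩ := hK.exists_of_mapsTo (f := δ) (y := z) δ.injective (fun t ht r hr hlive hn => by
    obtain ⟨r', ⟨hr', hn'⟩, rfl⟩ := Set.Finite.exists_of_mapsTo (K := {r : GuardedTree C |
        IsLive C r.1 ∧ r.level = n}) (f := δ) ((finite_level_le n).subset fun _ h => h.2.le)
      δ.injective (fun r h => ⟨isLive_apply δ h.1, (hl r h.1).trans h.2⟩) ⟨hlive, hn⟩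
    exact ht r' (δ.le_iff_le.1 hr) hr' hn') (fun r hr _ hn => by have := level_mono hr; omega)
  exact ⟨y, hy⟩

/-- A nontrivial self-embedding maps nodes just above a level at which the infinite part of the
tree splits beyond the next such level. -/
theorem exists_level_jump (hδ : ¬ Function.Surjective δ) :
    ∃ n, ∀ b ≥ n, (∀ x, C b x) →
      ∃ s : GuardedTree C, s.level = b + 1 ∧ ∃ b' > b, (∀ x, C b' x) ∧ b' < (δ s).level := by
  obtain ⟨s, hs, hlt⟩ := exists_isLive_level_lt δ hδ
  refine ⟨s.level, fun b hb hCb => ?_⟩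
  obtain ⟨k, rfl⟩ := Nat.exists_eq_add_of_le hb
  have hq : IsLive C (zeros hs k).1 := hs.append_zeros k
  have hql : (zeros hs k).1.length = s.level + k := level_zeros hs k
  have h0 := hq.concat (a := 0) (by norm_num) (by norm_num)
  have h1 := hq.concat (a := 1) (by norm_num) (fun _ => hql ▸ hCb)
  have hδq : s.level + k < (δ (zeros hs k)).level := by
    have := level_add_le δ k (le_zeros hs k) (level_zeros hs k)
    omega
  have hq0 : zeros hs k ≤ ofLive h0 := List.prefix_append _ _
  have hq1 : zeros hs k ≤ ofLive h1 := List.prefix_append _ _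
  have hn01 : ¬ ofLive h0 ≤ ofLive h1 := fun h => by
    simpa [ofLive] using List.IsPrefix.eq_of_length h (by simp [ofLive])
  have hn10 : ¬ ofLive h1 ≤ ofLive h0 := fun h => by
    simpa [ofLive] using List.IsPrefix.eq_of_length h (by simp [ofLive])
  -- The images of the two successors are incomparable, so they differ at some level i. Both extend
  -- the image of their common predecessor, so i is no less than its level.
  obtain ⟨i, u, v, hu, hv, huv⟩ := List.exists_getElem?_ne (mt δ.le_iff_le.1 hn01)
    (mt δ.le_iff_le.1 hn10)
  have hi : (δ (zeros hs k)).level ≤ i := by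
    by_contra! hi
    rw [← List.IsPrefix.getElem?_eq_of_lt (δ.monotone hq0) hi] at hu
    rw [← List.IsPrefix.getElem?_eq_of_lt (δ.monotone hq1) hi, hu] at hv
    exact huv (Option.some.inj hv)
  refine ⟨ofLive h0, by simp [ofLive, level, hql], i, by omega, ?_,
    (List.getElem?_eq_some_iff.1 hu).1⟩
  -- Both images are live and one of them turns right at i, so i satisfies the full condition.
  have hu' := isLive_apply δ (s := ofLive h0) h0 i u hu
  have hv' := isLive_apply δ (s := ofLive h1) h1 i v hv
  by_cases hu1 : u = 1
  · exact hu'.2 hu1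
  · exact hv'.2 (by omega)

end Embedding

end GuardedTree

/-! ### A computable presentation of a tree of guarded strings -/

section Bounded

variable {α : Type*} [Primcodable α] {p : α → ℕ → Prop} {n : α → ℕ}

theorem PrimrecPred.forall_lt_bound (hp : PrimrecPred fun x : α × ℕ => p x.1 x.2)
    (hn : Primrec n) : PrimrecPred fun a => ∀ i < n a, p a i := by
  have hR : PrimrecRel fun (i : ℕ) (a : α) => p a i := hp.comp (Primrec.snd.pair Primrec.fst)
  exact (hR.forall_mem_list.comp (Primrec.list_range.comp hn) Primrec.id).of_eq (by simp)

theorem PrimrecPred.exists_lt_bound (hp : PrimrecPred fun x : α × ℕ => p x.1 x.2)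
    (hn : Primrec n) : PrimrecPred fun a => ∃ i < n a, p a i := by
  have hR : PrimrecRel fun (i : ℕ) (a : α) => p a i := hp.comp (Primrec.snd.pair Primrec.fst)
  exact (hR.exists_mem_list.comp (Primrec.list_range.comp hn) Primrec.id).of_eq (by simp)

end Bounded

/-! ### Invariance under order isomorphism -/

section OrderIso

variable {T T' : Type} [PartialOrder T] [PartialOrder T']

theorem IsTree.of_orderIso (e : T ≃o T') (h : IsTree T') : IsTree T where
  exists_root := by
    obtain ⟨r, hr⟩ := h.exists_root
    exact ⟨e.symm r, fun n => e.symm_apply_le.2 (hr _)⟩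
  finite_below n := by
    refine Set.Finite.of_finite_image (f := e) ((h.finite_below (e n)).subset ?_)
      e.injective.injOn
    rintro _ ⟨m, hm, rfl⟩
    exact e.monotone hm
  chain_below n := by
    intro a ha b hb _
    rcases (h.chain_below (e n)).total (e.monotone ha) (e.monotone hb) with h | h
    · exact Or.inl (e.le_iff_le.1 h)
    · exact Or.inr (e.le_iff_le.1 h)

theorem IsTreePath.image (e : T ≃o T') {P : Set T} (h : IsTreePath P) : IsTreePath (e '' P) :=
  ⟨h.1.image e.injective.injOn, h.2.image (e : (· ≤ · : T → T → Prop) ≃r (· ≤ · : T' → T' → Prop))⟩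

theorem IsInfiniteNode.map (e : T ≃o T') {n : T} (h : IsInfiniteNode n) : IsInfiniteNode (e n) := by
  refine (h.image e.injective.injOn).mono ?_
  rintro _ ⟨m, hm, rfl⟩
  exact e.monotone hm

theorem IsTypeThree.of_orderIso (e : T ≃o T') (h : IsTypeThree T') : IsTypeThree T where
  infinite := by
    have := h.infinite
    exact Infinite.of_injective e.symm e.symm.injective
  no_maximal_infinite_node n := by
    rintro ⟨h₁, h₂⟩
    refine h.no_maximal_infinite_node (e n) ⟨h₁.map e, fun m hm hinf => ?_⟩
    exact h₂ (e.symm m) (e.lt_symm_apply.2 hm) (hinf.map e.symm)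
  no_isolated_path P := by
    rintro ⟨hP, n, hn, hu⟩
    refine h.no_isolated_path (e '' P) ⟨hP.image e, e n, ⟨n, hn, rfl⟩, fun Q hQ hnQ => ?_⟩
    rw [← hu (e.symm '' Q) (hQ.image e.symm) ⟨e n, hnQ, e.symm_apply_apply n⟩]
    rw [Set.image_image]
    simp

theorem ncard_lt_orderIso (e : T ≃o T') (n : T) : {m | m < e n}.ncard = {m | m < n}.ncard := by
  rw [← Set.ncard_image_of_injective _ e.injective]
  congr 1
  ext m
  constructor
  · exact fun hm => ⟨e.symm m, e.symm_apply_lt.2 hm, e.apply_symm_apply m⟩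
  · rintro ⟨k, hk, rfl⟩
    exact e.strictMono hk

end OrderIso

/-- The string `l` is guarded by the predicates `fun i x => ∃ y, Ψ i x y`, as witnessed below
`s`. -/
def GuardedBelow (Ψ : ℕ → ℕ → ℕ → Prop) (l : List ℕ) (s : ℕ) : Prop :=
  ∀ i < l.length, l.getD i 0 = 0 ∨ l.getD i 0 = 1 ∧ ∀ x < l.length, ∃ y < s, Ψ i x y

/-- Being guarded is a finite conjunction of existential statements, so one bound serves for all of
them. Adding the least such bound to the code of the string makes the node set computable rather
than just enumerable. -/
theorem isGuarded_iff_exists_guardedBelow {Ψ : ℕ → ℕ → ℕ → Prop} {l : List ℕ} :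
    IsGuarded (fun i x => ∃ y, Ψ i x y) l ↔ ∃ s, GuardedBelow Ψ l s := by
  constructor
  · intro h
    have key : ∀ᶠ s in Filter.atTop, ∀ i ∈ Set.Iio l.length, l.getD i 0 = 0 ∨ l.getD i 0 = 1 ∧
        ∀ x < l.length, ∃ y < s, Ψ i x y := by
      rw [Filter.eventually_all_finite (Set.finite_Iio _)]
      intro i hi
      have hi' : l[i]? = some (l.getD i 0) := by
        rw [List.getD_eq_getElem _ _ hi, List.getElem?_eq_getElem hi]
      obtain ⟨h₁, h₂⟩ := h i _ hi'
      rcases Nat.le_one_iff_eq_zero_or_eq_one.1 h₁ with h0 | h1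
      · exact Filter.Eventually.of_forall fun _ => Or.inl h0
      · have : ∀ᶠ s in Filter.atTop, ∀ x ∈ Set.Iio l.length, ∃ y < s, Ψ i x y := by
          rw [Filter.eventually_all_finite (Set.finite_Iio _)]
          intro x hx
          obtain ⟨y, hy⟩ := h₂ h1 x hx
          filter_upwards [Filter.eventually_gt_atTop y] with s hs
          exact ⟨y, hs, hy⟩
        filter_upwards [this] with s hs
        exact Or.inr ⟨h1, hs⟩
    exact key.exists
  · rintro ⟨s, hs⟩ i a hi
    have hlt := (List.getElem?_eq_some_iff.1 hi).1
    have ha : l.getD i 0 = a := by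
      rw [List.getD_eq_getElem?_getD, hi, Option.getD_some]
    rcases hs i hlt with h0 | ⟨h1, h⟩
    · exact ⟨by omega, fun h => by omega⟩
    · refine ⟨by omega, fun _ x hx => ?_⟩
      obtain ⟨y, -, hy⟩ := h x hx
      exact ⟨y, hy⟩

theorem primrecPred_guardedBelow {Ψ : ℕ → ℕ → ℕ → Prop}
    (hΨ : PrimrecPred fun x : ℕ × ℕ × ℕ => Ψ x.1 x.2.1 x.2.2) :
    PrimrecPred fun x : List ℕ × ℕ => GuardedBelow Ψ x.1 x.2 := by
  have hlen : Primrec fun x : List ℕ × ℕ => x.1.length := Primrec.list_length.comp Primrec.fst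
  have hget : Primrec fun x : (List ℕ × ℕ) × ℕ => x.1.1.getD x.2 0 :=
    (Primrec.list_getD 0).comp (Primrec.fst.comp Primrec.fst) Primrec.snd
  have h₀ : PrimrecPred fun z : (((List ℕ × ℕ) × ℕ) × ℕ) × ℕ => Ψ z.1.1.2 z.1.2 z.2 :=
    hΨ.comp ((Primrec.snd.comp (Primrec.fst.comp Primrec.fst)).pair
      ((Primrec.snd.comp Primrec.fst).pair Primrec.snd))
  have h₁ := PrimrecPred.exists_lt_bound
    (p := fun (z : ((List ℕ × ℕ) × ℕ) × ℕ) y => Ψ z.1.2 z.2 y) h₀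
    (n := fun z => z.1.1.2) (Primrec.snd.comp (Primrec.fst.comp Primrec.fst))
  have h₂ := PrimrecPred.forall_lt_bound
    (p := fun (z : (List ℕ × ℕ) × ℕ) x => ∃ y < z.1.2, Ψ z.2 x y) h₁
    (n := fun z => z.1.1.length) (hlen.comp Primrec.fst)
  exact PrimrecPred.forall_lt_bound
    (p := fun (z : List ℕ × ℕ) i => z.1.getD i 0 = 0 ∨ z.1.getD i 0 = 1 ∧
      ∀ x < z.1.length, ∃ y < z.2, Ψ i x y)
    ((Primrec.eq.comp hget (Primrec.const 0)).or
      ((Primrec.eq.comp hget (Primrec.const 1)).and h₂)) hlen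

/-- The string coded by the first component of a number. -/
def stringOf (m : ℕ) : List ℕ := Denumerable.ofNat (List ℕ) m.unpair.1

theorem primrec_stringOf : Primrec stringOf :=
  (Primrec.ofNat (List ℕ)).comp (Primrec.fst.comp Primrec.unpair)

/-- Codes of guarded strings: pairs of a string and the least bound that witnesses that the string
is guarded. -/
def guardedCodes (Ψ : ℕ → ℕ → ℕ → Prop) : Set ℕ :=
  {m | GuardedBelow Ψ (stringOf m) m.unpair.2 ∧
    ∀ s < m.unpair.2, ¬ GuardedBelow Ψ (stringOf m) s}

theorem primrecPred_guardedCodes {Ψ : ℕ → ℕ → ℕ → Prop}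
    (hΨ : PrimrecPred fun x : ℕ × ℕ × ℕ => Ψ x.1 x.2.1 x.2.2) :
    PrimrecPred fun m => m ∈ guardedCodes Ψ := by
  have h := primrecPred_guardedBelow hΨ
  have hr : Primrec fun m : ℕ => m.unpair.2 := Primrec.snd.comp Primrec.unpair
  have h₁ : PrimrecPred fun m : ℕ => GuardedBelow Ψ (stringOf m) m.unpair.2 :=
    h.comp (primrec_stringOf.pair hr)
  have h₂ : PrimrecPred fun z : ℕ × ℕ => ¬ GuardedBelow Ψ (stringOf z.1) z.2 :=
    (h.comp ((primrec_stringOf.comp Primrec.fst).pair Primrec.snd)).not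
  exact h₁.and (PrimrecPred.forall_lt_bound
    (p := fun (m s : ℕ) => ¬ GuardedBelow Ψ (stringOf m) s) h₂ hr)

/-- The guarded string that a code stands for. -/
noncomputable def guardedCodesEquiv (Ψ : ℕ → ℕ → ℕ → Prop) :
    guardedCodes Ψ ≃ GuardedTree fun i x => ∃ y, Ψ i x y :=
  Equiv.ofBijective
    (fun m => ⟨stringOf m.1, isGuarded_iff_exists_guardedBelow.2 ⟨_, m.2.1⟩⟩) <| by
    constructor
    · rintro ⟨m, hm, hm'⟩ ⟨k, hk, hk'⟩ h
      have h₁ : stringOf m = stringOf k := congrArg Subtype.val h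
      have h₂ : m.unpair.2 = k.unpair.2 := by
        rcases lt_trichotomy m.unpair.2 k.unpair.2 with h | h | h
        · exact absurd (h₁ ▸ hm) (hk' _ h)
        · exact h
        · exact absurd (h₁.symm ▸ hk) (hm' _ h)
      have h₃ : m.unpair.1 = k.unpair.1 := by
        have := congrArg Encodable.encode h₁
        simpa [stringOf] using this
      exact Subtype.ext (show m = k by rw [← Nat.pair_unpair m, h₂, h₃, Nat.pair_unpair])
    · rintro ⟨l, hl⟩
      classical
      have hl' := isGuarded_iff_exists_guardedBelow.1 hl
      have hs : stringOf (Nat.pair (Encodable.encode l) (Nat.find hl')) = l := by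
        simp [stringOf]
      refine ⟨⟨Nat.pair (Encodable.encode l) (Nat.find hl'), ?_, ?_⟩, Subtype.ext hs⟩
      · rw [hs, Nat.unpair_pair]
        exact Nat.find_spec hl'
      · rw [hs, Nat.unpair_pair]
        exact fun s hs => Nat.find_min hl' hs

/-- The tree of guarded strings as a tree on a set of natural numbers. -/
noncomputable def guardedNatTree (Ψ : ℕ → ℕ → ℕ → Prop) : NatTree where
  carrier := guardedCodes Ψ
  order := PartialOrder.lift _ (guardedCodesEquiv Ψ).injective
  isTree := @IsTree.of_orderIso _ _
    (PartialOrder.lift _ (guardedCodesEquiv Ψ).injective) _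
    (@RelIso.mk _ _ (_) (_) (guardedCodesEquiv Ψ) Iff.rfl) GuardedTree.isTree

/-- The nodes of the tree are the guarded strings. -/
noncomputable def guardedNatTreeIso (Ψ : ℕ → ℕ → ℕ → Prop) :
    (guardedNatTree Ψ).Node ≃o GuardedTree fun i x => ∃ y, Ψ i x y :=
  ⟨guardedCodesEquiv Ψ, Iff.rfl⟩

theorem isComputable_guardedNatTree {Ψ : ℕ → ℕ → ℕ → Prop}
    (hΨ : PrimrecPred fun x : ℕ × ℕ × ℕ => Ψ x.1 x.2.1 x.2.2) :
    (guardedNatTree Ψ).IsComputable where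
  carrier := (primrecPred_guardedCodes hΨ).computablePred
  order := by
    have h := primrecPred_guardedCodes hΨ
    have h₁ : Primrec fun p : ℕ × ℕ => stringOf p.1 := primrec_stringOf.comp Primrec.fst
    have h₂ : Primrec fun p : ℕ × ℕ => stringOf p.2 := primrec_stringOf.comp Primrec.snd
    have h₃ : PrimrecPred fun p : ℕ × ℕ =>
        stringOf p.1 = (stringOf p.2).take (stringOf p.1).length :=
      Primrec.eq.comp h₁ (Primrec.list_take.comp (Primrec.list_length.comp h₁) h₂)
    refine (((h.comp Primrec.fst).and ((h.comp Primrec.snd).and h₃)).of_eq ?_).computablePred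
    rintro ⟨m, k⟩
    rw [← List.prefix_iff_eq_take]
    exact ⟨fun ⟨a, b, c⟩ => ⟨a, b, c⟩, fun ⟨a, b, c⟩ => ⟨a, b, c⟩⟩

/-! ### A sparse set of levels -/

section Levels

variable (R : ℕ → ℕ → ℕ → Prop)

/-- The matrix of a `Π⁰₂` definition of the graph of `leastWitness`. -/
def WitnessMatrix (e v x y : ℕ) : Prop :=
  v = 0 ∧ ¬ R e x y ∨ v ≠ 0 ∧ R e (v - 1) x ∧ (¬ x < v - 1 ∨ ¬ R e x y)

open Classical in
/-- `0` if there is no `s` with `∀ t, R e s t`, and the successor of the least such `s`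
otherwise. -/
noncomputable def leastWitness (e : ℕ) : ℕ :=
  if h : ∃ s, ∀ t, R e s t then Nat.find h + 1 else 0

variable {R}

/-- For v = 0 the condition refutes every witness. For v > 0 it makes v - 1 a witness, a `Π⁰₁` fact,
and refutes the finitely many smaller ones. -/
theorem witnessMatrix_iff {e v : ℕ} : (∀ x, ∃ y, WitnessMatrix R e v x y) ↔ leastWitness R e = v := by
  classical
  unfold leastWitness
  split_ifs with h
  · constructor
    · intro hv
      have hv0 : v ≠ 0 := by
        rintro rfl
        obtain ⟨s, hs⟩ := h
        obtain ⟨y, ⟨-, hy⟩ | ⟨h0, -⟩⟩ := hv s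
        exacts [hy (hs y), h0 rfl]
      obtain ⟨v, rfl⟩ := Nat.exists_eq_succ_of_ne_zero hv0
      refine congrArg Nat.succ ?_
      refine (Nat.find_eq_iff h).2 ⟨fun x => ?_, fun x hx hR => ?_⟩
      · obtain ⟨y, ⟨h0, -⟩ | ⟨-, h1, -⟩⟩ := hv x
        exacts [absurd h0 hv0, h1]
      · obtain ⟨y, ⟨h0, -⟩ | ⟨-, -, h1 | h1⟩⟩ := hv x
        exacts [hv0 h0, h1 hx, h1 (hR y)]
    · rintro rfl x
      by_cases hx : x < Nat.find h
      · have := Nat.find_min h hx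
        push Not at this
        obtain ⟨y, hy⟩ := this
        exact ⟨y, Or.inr ⟨Nat.succ_ne_zero _, Nat.find_spec h x, Or.inr hy⟩⟩
      · exact ⟨0, Or.inr ⟨Nat.succ_ne_zero _, Nat.find_spec h x, Or.inl hx⟩⟩
  · push Not at h
    constructor
    · intro hv
      by_contra hv0
      obtain ⟨t, ht⟩ := h (v - 1)
      obtain ⟨y, ⟨h0, -⟩ | ⟨-, h1, -⟩⟩ := hv t
      exacts [hv0 h0.symm, ht h1]
    · rintro rfl x
      obtain ⟨y, hy⟩ := h x
      exact ⟨y, Or.inl ⟨rfl, hy⟩⟩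

variable (R)

/-- The matrix of a `Π⁰₂` definition of the set of codes of the strings
`[f (n - 1), …, f 0]`, for `f` the least witness function. -/
def LevelMatrix (b x y : ℕ) : Prop :=
  (Denumerable.ofNat (List ℕ) b).length ≤ x.unpair.1 ∨
    WitnessMatrix R ((Denumerable.ofNat (List ℕ) b).length - 1 - x.unpair.1)
      ((Denumerable.ofNat (List ℕ) b).getD x.unpair.1 0) x.unpair.2 y

theorem primrecPred_levelMatrix {R : ℕ → ℕ → ℕ → Prop}
    (hR : PrimrecPred fun x : ℕ × ℕ × ℕ => R x.1 x.2.1 x.2.2) :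
    PrimrecPred fun x : ℕ × ℕ × ℕ => LevelMatrix R x.1 x.2.1 x.2.2 := by
  have hl : Primrec fun x : ℕ × ℕ × ℕ => Denumerable.ofNat (List ℕ) x.1 :=
    (Primrec.ofNat (List ℕ)).comp Primrec.fst
  have hlen : Primrec fun x : ℕ × ℕ × ℕ => (Denumerable.ofNat (List ℕ) x.1).length :=
    Primrec.list_length.comp hl
  have hx : Primrec fun x : ℕ × ℕ × ℕ => x.2.1.unpair :=
    Primrec.unpair.comp (Primrec.fst.comp Primrec.snd)
  have hi : Primrec fun x : ℕ × ℕ × ℕ => x.2.1.unpair.1 := Primrec.fst.comp hx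
  have he : Primrec fun x : ℕ × ℕ × ℕ =>
      (Denumerable.ofNat (List ℕ) x.1).length - 1 - x.2.1.unpair.1 :=
    Primrec.nat_sub.comp (Primrec.nat_sub.comp hlen (Primrec.const 1)) hi
  have hv : Primrec fun x : ℕ × ℕ × ℕ => (Denumerable.ofNat (List ℕ) x.1).getD x.2.1.unpair.1 0 :=
    (Primrec.list_getD 0).comp hl hi
  have hM : PrimrecPred fun z : (ℕ × ℕ) × ℕ × ℕ => WitnessMatrix R z.1.1 z.1.2 z.2.1 z.2.2 := by
    have e : Primrec fun z : (ℕ × ℕ) × ℕ × ℕ => z.1.1 := Primrec.fst.comp Primrec.fst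
    have v : Primrec fun z : (ℕ × ℕ) × ℕ × ℕ => z.1.2 := Primrec.snd.comp Primrec.fst
    have x : Primrec fun z : (ℕ × ℕ) × ℕ × ℕ => z.2.1 := Primrec.fst.comp Primrec.snd
    have y : Primrec fun z : (ℕ × ℕ) × ℕ × ℕ => z.2.2 := Primrec.snd.comp Primrec.snd
    have v' : Primrec fun z : (ℕ × ℕ) × ℕ × ℕ => z.1.2 - 1 :=
      Primrec.nat_sub.comp v (Primrec.const 1)
    have v0 : PrimrecPred fun z : (ℕ × ℕ) × ℕ × ℕ => z.1.2 = 0 :=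
      Primrec.eq.comp v (Primrec.const 0)
    have r : PrimrecPred fun z : (ℕ × ℕ) × ℕ × ℕ => R z.1.1 z.2.1 z.2.2 := hR.comp (e.pair (x.pair y))
    have r' : PrimrecPred fun z : (ℕ × ℕ) × ℕ × ℕ => R z.1.1 (z.1.2 - 1) z.2.1 :=
      hR.comp (e.pair (v'.pair x))
    exact (v0.and r.not).or (v0.not.and (r'.and ((Primrec.nat_lt.comp x v').not.or r.not)))
  exact (Primrec.nat_le.comp hlen hi).or (hM.comp ((he.pair hv).pair
    ((Primrec.snd.comp hx).pair (Primrec.snd.comp Primrec.snd))))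

/-- The initial segments of the least witness function, the last value first. -/
noncomputable def witnessList : ℕ → List ℕ
  | 0 => []
  | n + 1 => leastWitness R n :: witnessList n

/-- The codes of the initial segments of the least witness function. -/
noncomputable def witnessCode (n : ℕ) : ℕ := Encodable.encode (witnessList R n)

theorem length_witnessList (n : ℕ) : (witnessList R n).length = n := by
  induction n with
  | zero => rfl
  | succ n ih => simp [witnessList, ih]

/-- Lists are stored with the last value first so that extending the segment is a `cons`; its code
exceeds both the new value and the old code. -/
theorem witnessCode_succ (n : ℕ) :
    witnessCode R (n + 1) = Nat.pair (leastWitness R n) (witnessCode R n) + 1 := rfl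

theorem witnessCode_strictMono : StrictMono (witnessCode R) :=
  strictMono_nat_of_lt_succ fun n => by
    rw [witnessCode_succ]
    exact Nat.lt_succ_of_le (Nat.right_le_pair _ _)

theorem leastWitness_lt_witnessCode (n : ℕ) : leastWitness R n < witnessCode R (n + 1) := by
  rw [witnessCode_succ]
  exact Nat.lt_succ_of_le (Nat.left_le_pair _ _)

theorem eq_witnessList_iff (l : List ℕ) :
    (∀ i < l.length, leastWitness R (l.length - 1 - i) = l.getD i 0) ↔
      l = witnessList R l.length := by
  induction l with
  | nil => simp [witnessList]
  | cons a l ih =>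
    simp only [List.length_cons, witnessList, List.cons.injEq, ← ih]
    constructor
    · intro h
      refine ⟨by simpa using (h 0 (by omega)).symm, fun i hi => ?_⟩
      have := h (i + 1) (by omega)
      rw [List.getD_cons_succ] at this
      rw [← this]
      congr 1
      omega
    · rintro ⟨rfl, h⟩ i hi
      cases i with
      | zero => simp
      | succ i =>
        rw [List.getD_cons_succ, ← h i (by omega)]
        congr 1
        omega

/-- The variable x codes a position in the list and an instance of the `Π⁰₂` condition on the entry
there. Positions beyond the end hold vacuously. -/
theorem levelMatrix_iff (b : ℕ) : (∀ x, ∃ y, LevelMatrix R b x y) ↔ b ∈ Set.range (witnessCode R) := by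
  have h₁ : (∀ x, ∃ y, LevelMatrix R b x y) ↔
      ∀ i < (Denumerable.ofNat (List ℕ) b).length,
        leastWitness R ((Denumerable.ofNat (List ℕ) b).length - 1 - i) =
          (Denumerable.ofNat (List ℕ) b).getD i 0 := by
    simp only [← witnessMatrix_iff]
    constructor
    · intro h i hi x
      obtain ⟨y, hy⟩ := h (Nat.pair i x)
      simp only [LevelMatrix, Nat.unpair_pair] at hy
      exact ⟨y, hy.resolve_left (not_le.2 hi)⟩
    · intro h x
      by_cases hx : (Denumerable.ofNat (List ℕ) b).length ≤ x.unpair.1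
      · exact ⟨0, Or.inl hx⟩
      · obtain ⟨y, hy⟩ := h x.unpair.1 (not_le.1 hx) x.unpair.2
        exact ⟨y, Or.inr hy⟩
  rw [h₁, eq_witnessList_iff]
  constructor
  · intro h
    refine ⟨_, (congrArg Encodable.encode h).symm.trans ?_⟩
    simp
  · rintro ⟨n, rfl⟩
    simp [witnessCode, length_witnessList]

end Levels

/-! ### Levels of computable trees and growth of self-embeddings -/

theorem ComputablePred.or {α : Type*} [Primcodable α] {p q : α → Prop} (hp : ComputablePred p)
    (hq : ComputablePred q) : ComputablePred fun a => p a ∨ q a := by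
  obtain ⟨f, hf, rfl⟩ := ComputablePred.computable_iff.1 hp
  obtain ⟨g, hg, rfl⟩ := ComputablePred.computable_iff.1 hq
  exact ComputablePred.computable_iff.2
    ⟨fun a => f a || g a, Primrec.or.to_comp.comp hf hg, by simp⟩

namespace NatTree

variable {T : NatTree}

theorem isTree_node (T : NatTree) : IsTree T.Node := T.isTree

theorem val_mem (x : T.Node) : T.val x ∈ T.carrier := x.2

theorem node_val (x : T.Node) (h : T.val x ∈ T.carrier) : T.node (T.val x) h = x := rfl

theorem val_injective : Function.Injective T.val := Subtype.val_injective

/-- The number of `z < n` with `f (z, y)`. -/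
def countBelow (f : ℕ × ℕ → Bool) (y n : ℕ) : ℕ :=
  n.rec 0 fun z i => i + (f (z, y)).toNat

theorem countBelow_eq (f : ℕ × ℕ → Bool) (y n : ℕ) :
    countBelow f y n = {z | z < n ∧ f (z, y) = true}.ncard := by
  have h : ∀ n, countBelow f y n = ((Finset.range n).filter fun z => f (z, y) = true).card := by
    intro n
    induction n with
    | zero => rfl
    | succ n ih =>
      change countBelow f y n + (f (n, y)).toNat = _
      rw [ih, Finset.range_add_one, Finset.filter_insert]
      cases h : f (n, y)
      · simp
      · simp
  rw [h, ← Set.ncard_coe_finset]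
  congr 1
  ext z
  simp

theorem computable_countBelow {f : ℕ × ℕ → Bool} (hf : Computable f) :
    Computable fun p : ℕ × ℕ => countBelow f p.1 p.2 := by
  refine Computable.nat_rec (f := fun p : ℕ × ℕ => p.2) (g := fun _ => 0)
    (h := fun p z => z.2 + (f (z.1, p.1)).toNat) Computable.snd (Computable.const 0) ?_
  exact Primrec.nat_add.to_comp.comp (Computable.snd.comp Computable.snd)
    ((Primrec.dom_bool Bool.toNat).to_comp.comp (hf.comp ((Computable.fst.comp Computable.snd).pair
      (Computable.fst.comp Computable.fst))))

/-- The strict order of a computable tree has a computable characteristic function. -/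
theorem IsComputable.exists_lt (hT : T.IsComputable) :
    ∃ f : ℕ × ℕ → Bool, Computable f ∧
      ∀ a b, f (a, b) = true ↔ ∃ x y : T.Node, T.val x = a ∧ T.val y = b ∧ x < y := by
  have hne : ComputablePred fun p : ℕ × ℕ => p.1 = p.2 :=
    (Primrec.eq.comp Primrec.fst Primrec.snd).computablePred
  obtain ⟨f, hf, hf'⟩ := ComputablePred.computable_iff.1 (hT.order.not.or hne).not
  refine ⟨f, hf, fun a b => ?_⟩
  have := congrFun hf' (a, b)
  simp only [eq_iff_iff, not_or, not_not] at this
  rw [← this]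
  constructor
  · rintro ⟨⟨ha, hb, hle⟩, hab⟩
    exact ⟨T.node a ha, T.node b hb, rfl, rfl, lt_of_le_of_ne hle fun h =>
      hab (congrArg T.val h)⟩
  · rintro ⟨x, y, rfl, rfl, hxy⟩
    exact ⟨⟨val_mem x, val_mem y, hxy.le⟩, fun h => hxy.ne (val_injective h)⟩

/-- `0'` bounds the nodes of a given level in a computable finitely branching tree. -/
theorem IsComputable.exists_bound_of_level_le (hT : T.IsComputable)
    (hfin : ∀ n : ℕ, ∃ F : Set T.Node, F.Finite ∧ ∀ y ∉ F, n < {z ∈ F | z < y}.ncard) :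
    ∃ N : ℕ → ℕ, (N : ℕ →. ℕ) ≤ᵀ (zeroJump : ℕ →. ℕ) ∧
      ∀ n (x : T.Node), {z | z < x}.ncard ≤ n → T.val x < N n := by
  obtain ⟨f, hf, hf'⟩ := hT.exists_lt
  -- The matrix says of a bound m that each node y ≥ m has more than n predecessors among the
  -- numbers below m. Counting only below m keeps it computable.
  have hP : ComputablePred fun x : ℕ × ℕ × ℕ =>
      (¬ x.2.2 ∈ T.carrier ∨ x.2.2 < x.2.1) ∨ x.1 < countBelow f x.2.2 x.2.1 := by
    have hn : Computable fun x : ℕ × ℕ × ℕ => x.2.1 := Computable.fst.comp Computable.snd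
    have hy : Computable fun x : ℕ × ℕ × ℕ => x.2.2 := Computable.snd.comp Computable.snd
    have hlt : ComputablePred fun p : ℕ × ℕ => p.1 < p.2 :=
      (Primrec.nat_lt.comp Primrec.fst Primrec.snd).computablePred
    exact ((hT.carrier.comp_computable hy).not.or (hlt.comp_computable (hy.pair hn))).or
      (hlt.comp_computable (Computable.fst.pair ((computable_countBelow hf).comp (hy.pair hn))))
  obtain ⟨N, hN, hN'⟩ := exists_zeroJump_witness
    (P := fun n m y => (¬ y ∈ T.carrier ∨ y < m) ∨ n < countBelow f y m) hP fun n => by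
      obtain ⟨F, hF, hF'⟩ := hfin n
      obtain ⟨m, hm⟩ := (hF.image T.val).bddAbove
      refine ⟨m + 1, fun y => ?_⟩
      by_contra! h
      obtain ⟨⟨hy, hmy⟩, hc⟩ := h
      refine absurd (hF' (T.node y hy) fun hmem => ?_) (not_lt.2 (le_trans ?_ hc))
      · have : y ≤ m := hm ⟨_, hmem, rfl⟩
        omega
      · rw [countBelow_eq, ← Set.ncard_image_of_injective _ (val_injective (T := T))]
        refine Set.ncard_le_ncard ?_ ((Set.finite_Iio (m + 1)).subset fun z hz => hz.1)
        rintro _ ⟨z, ⟨hz, hlt⟩, rfl⟩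
        exact ⟨Nat.lt_succ_of_le (hm ⟨z, hz, rfl⟩), (hf' _ _).2 ⟨z, T.node y hy, rfl, rfl, hlt⟩⟩
  refine ⟨N, hN, fun n x hx => ?_⟩
  rcases hN' n (T.val x) with (h | h) | h
  · exact absurd (val_mem x) h
  · exact h
  · refine absurd (h.trans_le ?_) (not_lt.2 hx)
    rw [countBelow_eq, ← Set.ncard_image_of_injective _ (val_injective (T := T))]
    refine Set.ncard_le_ncard ?_ (((T.isTree_node.finite_below x).subset fun z hz => le_of_lt hz).image _)
    rintro z ⟨-, hz⟩
    obtain ⟨u, v, rfl, hv, huv⟩ := (hf' _ _).1 hz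
    rw [val_injective hv] at huv
    exact ⟨u, huv, rfl⟩

/-- `0'` bounds the level of a node of a computable tree. -/
theorem IsComputable.exists_level_bound (hT : T.IsComputable) :
    ∃ V : ℕ → ℕ, (V : ℕ →. ℕ) ≤ᵀ (zeroJump : ℕ →. ℕ) ∧
      ∀ x : T.Node, {z | z < x}.ncard ≤ V (T.val x) := by
  obtain ⟨f, hf, hf'⟩ := hT.exists_lt
  have hP : ComputablePred fun x : ℕ × ℕ × ℕ => ¬ f (x.2.2, x.1) = true ∨ x.2.2 < x.2.1 := by
    have hy : Computable fun x : ℕ × ℕ × ℕ => x.2.2 := Computable.snd.comp Computable.snd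
    have hb : ComputablePred fun b : Bool => b = true :=
      (Primrec.eq.comp Primrec.id (Primrec.const true)).computablePred
    have hlt : ComputablePred fun p : ℕ × ℕ => p.1 < p.2 :=
      (Primrec.nat_lt.comp Primrec.fst Primrec.snd).computablePred
    exact (hb.comp_computable (hf.comp (hy.pair Computable.fst))).not.or
      (hlt.comp_computable (hy.pair (Computable.fst.comp Computable.snd)))
  have hfin : ∀ x : T.Node, {z | z < x}.Finite := fun x =>
    (T.isTree_node.finite_below x).subset fun z hz => le_of_lt hz
  obtain ⟨V, hV, hV'⟩ := exists_zeroJump_witness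
    (P := fun a v y => ¬ f (y, a) = true ∨ y < v) hP fun a => by
      by_cases ha : a ∈ T.carrier
      · obtain ⟨m, hm⟩ := ((hfin (T.node a ha)).image T.val).bddAbove
        refine ⟨m + 1, fun y => ?_⟩
        by_cases hy : f (y, a) = true
        · obtain ⟨u, v, rfl, rfl, huv⟩ := (hf' _ _).1 hy
          exact Or.inr (Nat.lt_succ_of_le (hm ⟨u, huv, rfl⟩))
        · exact Or.inl hy
      · refine ⟨0, fun y => Or.inl fun hy => ha ?_⟩
        obtain ⟨u, v, rfl, rfl, huv⟩ := (hf' _ _).1 hy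
        exact val_mem v
  refine ⟨V, hV, fun x => ?_⟩
  rw [← Set.ncard_image_of_injective _ (val_injective (T := T))]
  refine (Set.ncard_le_ncard (t := (Finset.range (V (T.val x)) : Set ℕ)) ?_
    (Finset.finite_toSet _)).trans ?_
  · rintro _ ⟨z, hz, rfl⟩
    have := (hV' (T.val x) (T.val z)).resolve_left (not_not.2 ((hf' _ _).2 ⟨z, x, rfl, rfl, hz⟩))
    simpa using this
  · rw [Set.ncard_coe_finset, Finset.card_range]

theorem mapFun_val (δ : T.Node → T.Node) (x : T.Node) :
    T.mapFun δ (T.val x) = T.val (δ x) := by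
  simp only [mapFun, val_mem, dif_pos, node_val]

/-- If the images under `δ` of the nodes of level at most `b n` have levels that grow beyond
`b (n + 1)`, then `0' ⊕ δ` computes a function that dominates `b`. -/
theorem IsComputable.exists_dominating (hT : T.IsComputable)
    (hfin : ∀ n : ℕ, ∃ F : Set T.Node, F.Finite ∧ ∀ y ∉ F, n < {z ∈ F | z < y}.ncard)
    (δ : T.Node → T.Node) {b : ℕ → ℕ}
    (hb : ∀ n, ∃ x : T.Node, {z | z < x}.ncard ≤ b n ∧ b (n + 1) ≤ {z | z < δ x}.ncard) :
    ∃ h : ℕ → ℕ, (h : ℕ →. ℕ) ≤ᵀ (turingJoin zeroJump (T.mapFun δ) : ℕ →. ℕ) ∧ ∀ n, b n ≤ h n := by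
  obtain ⟨N, hN, hN'⟩ := hT.exists_bound_of_level_le hfin
  obtain ⟨V, hV, hV'⟩ := hT.exists_level_bound
  replace hN := hN.trans (zeroJump_join (T.mapFun δ))
  replace hV := hV.trans (zeroJump_join (T.mapFun δ))
  have hunp : ∀ {g : ℕ →. ℕ}, ((fun p : ℕ => p.unpair.2 : ℕ → ℕ) : ℕ →. ℕ) ≤ᵀ g := fun {g} =>
    of_computable (computable_snd_unpair Computable.id)
  -- A sum serves as an upper bound for all its terms.
  let W : ℕ → ℕ := fun m => m.rec 0 fun x i => i + V (T.mapFun δ x)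
  have hW : (W : ℕ →. ℕ) ≤ᵀ (turingJoin zeroJump (T.mapFun δ) : ℕ →. ℕ) := by
    refine nat_rec_total (k := fun x i => i + V (T.mapFun δ x)) 0 ?_
    refine computable₂_total (k := fun i v => i + v) Primrec.nat_add.to_comp hunp
      (comp_total (f := fun p => V (T.mapFun δ p)) (h := fun p => p.unpair.1)
        (comp_total hV (right_join _)) (of_computable (computable_fst_unpair Computable.id)))
  have hWle : ∀ m x, x < m → V (T.mapFun δ x) ≤ W m := by
    intro m x hx
    induction m with
    | zero => omega
    | succ m ih =>
      change _ ≤ W m + V (T.mapFun δ m)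
      rcases Nat.lt_succ_iff_lt_or_eq.1 hx with h | rfl
      · have := ih h
        omega
      · omega
  -- The starting value `b 0` is a fixed constant. From a bound i on a level, `N i` bounds the nodes
  -- up to that level, and `W` bounds the levels of their images.
  let h : ℕ → ℕ := fun n => n.rec (b 0) fun _ i => W (N i)
  refine ⟨h, nat_rec_total (k := fun _ i => W (N i)) (b 0)
    (comp_total (f := fun i => W (N i)) (h := fun p => p.unpair.2) (comp_total hW hN) hunp),
    fun n => ?_⟩
  induction n with
  | zero => exact le_rfl
  | succ n ih =>
    obtain ⟨x, hx, hδx⟩ := hb n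
    have h₁ : T.val x < N (h n) := hN' _ x (hx.trans ih)
    calc b (n + 1) ≤ _ := hδx
      _ ≤ V (T.val (δ x)) := hV' (δ x)
      _ = V (T.mapFun δ (T.val x)) := by rw [mapFun_val]
      _ ≤ W (N (h n)) := hWle _ _ h₁

/-- Over a computable tree, a map with a `Δ⁰₂` graph is reducible to `0'`. -/
theorem IsComputable.mapFun_le_zeroJump (hT : T.IsComputable) {δ : T.Node → T.Node}
    (hδ : IsDeltaTwo (T.graph δ)) : (T.mapFun δ : ℕ →. ℕ) ≤ᵀ (zeroJump : ℕ →. ℕ) := by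
  classical
  -- The `Σ⁰₂` half suffices: the map is total on the nodes, so `0'` can search for the value
  -- together with its witness.
  obtain ⟨⟨R, hR, hR'⟩, -⟩ := hδ
  have hP : ComputablePred fun x : ℕ × ℕ × ℕ =>
      ¬ x.1 ∈ T.carrier ∨ R ((x.1, x.2.1.unpair.1), x.2.1.unpair.2, x.2.2) := by
    have hw : Computable fun x : ℕ × ℕ × ℕ => x.2.1 := Computable.fst.comp Computable.snd
    exact (hT.carrier.comp_computable Computable.fst).not.or (hR.comp_computable
      ((Computable.fst.pair (computable_fst_unpair hw)).pair
        ((computable_snd_unpair hw).pair (Computable.snd.comp Computable.snd))))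
  obtain ⟨k, hk, hk'⟩ := exists_zeroJump_witness
    (P := fun n w y => ¬ n ∈ T.carrier ∨ R ((n, w.unpair.1), w.unpair.2, y)) hP fun n => by
      by_cases hn : n ∈ T.carrier
      · obtain ⟨x, hx⟩ := (hR' (n, T.val (δ (T.node n hn)))).1 ⟨hn, rfl⟩
        exact ⟨Nat.pair (T.val (δ (T.node n hn))) x, fun y => Or.inr (by simpa using hx y)⟩
      · exact ⟨0, fun _ => Or.inl hn⟩
  have hc : Computable₂ fun n w : ℕ => if n ∈ T.carrier then w.unpair.1 else 0 := by
    refine (Computable.cond ((hT.carrier.comp_computable Computable.fst).decide)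
      (computable_fst_unpair Computable.snd) (Computable.const 0)).of_eq fun p => ?_
    rw [Bool.cond_decide]
  have key := computable₂_total hc (of_computable Computable.id) hk
  have he : (fun n => if id n ∈ T.carrier then (k n).unpair.1 else 0) = T.mapFun δ := by
    funext n
    simp only [mapFun, id]
    split_ifs with hn
    · obtain ⟨h, he⟩ := (hR' (n, (k n).unpair.1)).2 ⟨(k n).unpair.2, fun y =>
        (hk' n y).resolve_left (not_not.2 hn)⟩
      exact he.symm
    · rfl
  rwa [he] at key

end NatTree

/-! ### Computing `0''` from a dominating function, and the theorem -/

/-- A function that dominates the least witnesses of a `Σ⁰₂` definition of `0''` computes `0''`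
with the help of `0'`. -/
theorem zeroDoubleJump_le_of_dominating {R : ℕ → ℕ → ℕ → Prop}
    (hR : PrimrecPred fun x : ℕ × ℕ × ℕ => R x.1 x.2.1 x.2.2)
    (hR' : ∀ e, e ∈ turingJump (turingJump ∅) ↔ ∃ s, ∀ t, R e s t) {g : ℕ →. ℕ}
    (hg : (zeroJump : ℕ →. ℕ) ≤ᵀ g) {h : ℕ → ℕ} (hh : (h : ℕ →. ℕ) ≤ᵀ g)
    (hle : ∀ e, leastWitness R e ≤ h e) : (zeroDoubleJump : ℕ →. ℕ) ≤ᵀ g := by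
  classical
  have hP : PrimrecPred fun x : ℕ × ℕ => ∃ s < x.1.unpair.2, ∀ t < x.2, R x.1.unpair.1 s t := by
    have ha : Primrec fun x : ℕ × ℕ => x.1.unpair := Primrec.unpair.comp Primrec.fst
    have h₀ : PrimrecPred fun z : ((ℕ × ℕ) × ℕ) × ℕ => R z.1.1.1.unpair.1 z.1.2 z.2 :=
      hR.comp ((Primrec.fst.comp (ha.comp (Primrec.fst.comp Primrec.fst))).pair
        ((Primrec.snd.comp Primrec.fst).pair Primrec.snd))
    exact PrimrecPred.exists_lt_bound
      (p := fun (x : ℕ × ℕ) s => ∀ t < x.2, R x.1.unpair.1 s t)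
      (PrimrecPred.forall_lt_bound
        (p := fun (z : (ℕ × ℕ) × ℕ) t => R z.1.1.unpair.1 z.2 t) h₀
        (n := fun z => z.1.2) (Primrec.snd.comp Primrec.fst))
      (Primrec.snd.comp ha)
  obtain ⟨q, hq, hq'⟩ := exists_zeroJump_decides
    (P := fun a n => ∃ s < a.unpair.2, ∀ t < n, R a.unpair.1 s t) hP.computablePred
  have hc : Computable fun n : ℕ => if n = 0 then 1 else 0 :=
    (Primrec.ite (Primrec.eq.comp Primrec.id (Primrec.const 0)) (Primrec.const 1)
      (Primrec.const 0)).to_comp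
  have key := comp_total (of_computable hc) (comp_total (hq.trans hg)
    (pair_total (of_computable Computable.id) hh))
  have he : (fun e => if q (Nat.pair (id e) (h e)) = 0 then 1 else 0) = zeroDoubleJump := by
    funext e
    simp only [zeroDoubleJump, charFun, hq', hR', Nat.unpair_pair, id]
    congr 1
    rw [eq_iff_iff]
    constructor
    -- Compactness: if each of the finitely many s below the bound failed at some t, a stage beyond
    -- all these t would refute every s at once.
    · intro H
      by_contra! hne
      choose t ht using hne
      obtain ⟨s, hs, hs'⟩ := H ((Finset.range (h e)).sup t + 1)
      exact ht s (hs' _ (Nat.lt_succ_of_le (Finset.le_sup (Finset.mem_range.2 hs))))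
    · intro hex n
      have hlt := hle e
      rw [leastWitness, dif_pos hex] at hlt
      exact ⟨_, hlt, fun t _ => Nat.find_spec hex t⟩
  rwa [he] at key

theorem theorem5p15 :
    ∃ S : NatTree, S.IsComputable ∧ IsTypeThree S.Node ∧
      ∀ S' : NatTree, S'.IsComputable → Nonempty (S.Node ≃o S'.Node) →
        ∀ δ : S'.Node ↪o S'.Node, ¬ Function.Surjective δ →
          (zeroDoubleJump : ℕ →. ℕ) ≤ᵀ (turingJoin zeroJump (S'.mapFun δ) : ℕ →. ℕ) ∧
          ¬ IsDeltaTwo (S'.graph δ) ∧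
          ¬ (StrictTuringReducible zeroJump (S'.mapFun δ) ∧
              StrictTuringReducible (S'.mapFun δ) zeroDoubleJump) := by
  obtain ⟨R, hR, hR'⟩ := zeroDoubleJump_sigmaTwo
  have hinf : {b | ∀ x, ∃ y, LevelMatrix R b x y}.Infinite := by
    refine (Set.infinite_range_of_injective (witnessCode_strictMono R).injective).mono ?_
    exact fun b hb => (levelMatrix_iff R b).2 hb
  refine ⟨guardedNatTree (LevelMatrix R), isComputable_guardedNatTree (primrecPred_levelMatrix hR),
    (GuardedTree.isTypeThree hinf).of_orderIso (guardedNatTreeIso _), ?_⟩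
  rintro S' hS' ⟨e₀⟩ δ hδ
  let e : GuardedTree (fun b x => ∃ y, LevelMatrix R b x y) ≃o S'.Node :=
    (guardedNatTreeIso _).symm.trans e₀
  have hlevel : ∀ s, {z | z < e s}.ncard = s.level := fun s => by
    rw [ncard_lt_orderIso, GuardedTree.ncard_lt]
  have hmain : (zeroDoubleJump : ℕ →. ℕ) ≤ᵀ (turingJoin zeroJump (S'.mapFun δ) : ℕ →. ℕ) := by
    let δ' : GuardedTree (fun b x => ∃ y, LevelMatrix R b x y) ↪o GuardedTree _ :=
      e.toOrderEmbedding.trans (δ.trans e.symm.toOrderEmbedding)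
    have hδ' : ¬ Function.Surjective δ' := fun h => hδ fun y => by
      obtain ⟨s, hs⟩ := h (e.symm y)
      exact ⟨e s, e.symm.injective hs⟩
    obtain ⟨n, hn⟩ := GuardedTree.exists_level_jump δ' hδ'
    -- The finite set is that of the nodes of level at most k; a node outside it has k + 1
    -- predecessors there, at levels 0 to k.
    have hfin : ∀ k : ℕ, ∃ F : Set S'.Node, F.Finite ∧ ∀ y ∉ F, k < {z ∈ F | z < y}.ncard := by
      intro k
      refine ⟨e '' {s | s.level ≤ k}, (GuardedTree.finite_level_le k).image _, fun y hy => ?_⟩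
      obtain ⟨s, rfl⟩ := e.surjective y
      have hs : k < s.level := not_le.1 fun h => hy ⟨s, h, rfl⟩
      have hr := GuardedTree.level_restrict (s := s) (n := k + 1) hs
      rw [Nat.lt_iff_add_one_le, ← hr, ← GuardedTree.ncard_lt,
        ← Set.ncard_image_of_injective _ e.injective]
      refine Set.ncard_le_ncard ?_ (((GuardedTree.finite_level_le k).image e).subset
        fun z hz => hz.1)
      rintro _ ⟨t, ht, rfl⟩
      have ht' := GuardedTree.level_strictMono ht
      exact ⟨⟨t, by simp only [Set.mem_ofPred_eq]; omega, rfl⟩,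
        e.strictMono (lt_of_lt_of_le ht (s.restrict_le _))⟩
    -- The added 1 is the step from a splitting level to the successors of its nodes.
    have hgrow : ∀ k : ℕ, ∃ x : S'.Node, {z | z < x}.ncard ≤ witnessCode R (n + k) + 1 ∧
        witnessCode R (n + (k + 1)) + 1 ≤ {z | z < δ x}.ncard := by
      intro k
      obtain ⟨s, hs, b', hb', hC, hlt⟩ := hn (witnessCode R (n + k))
        ((Nat.le_add_right _ _).trans ((witnessCode_strictMono R).le_apply))
        ((levelMatrix_iff R _).2 ⟨_, rfl⟩)
      refine ⟨e s, by rw [hlevel, hs], ?_⟩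
      obtain ⟨j, rfl⟩ := (levelMatrix_iff R _).1 hC
      have hj : n + k < j := (witnessCode_strictMono R).lt_iff_lt.1 hb'
      have hmono := (witnessCode_strictMono R).monotone (show n + (k + 1) ≤ j from hj)
      have hδs : {z | z < δ (e s)}.ncard = (δ' s).level := by
        rw [← hlevel, show e (δ' s) = δ (e s) from e.apply_symm_apply _]
      rw [hδs]
      omega
    obtain ⟨h, hh, hle⟩ := hS'.exists_dominating (b := fun k => witnessCode R (n + k) + 1)
      hfin δ hgrow
    refine zeroDoubleJump_le_of_dominating hR hR' (zeroJump_join _)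
      -- The shift is needed because the value f(i) is bounded by the code of the segment of length
      -- i + 1.
      (comp_total hh (of_computable (f := fun i => i + 1) Computable.succ)) fun i => ?_
    have h₁ := leastWitness_lt_witnessCode R i
    have h₂ := (witnessCode_strictMono R).monotone (show i + 1 ≤ n + (i + 1) by omega)
    have h₃ := hle (i + 1)
    omega
  refine ⟨hmain, fun hΔ => ?_, fun hst => ?_⟩
  -- A `Δ⁰₂` embedding would be computable from `0'`, giving `0'' ≤ᵀ 0'`.
  · exact not_turingJump_le (turingJump ∅) (hmain.trans
      (join_le (TuringReducible.refl (zeroJump : ℕ →. ℕ)) (hS'.mapFun_le_zeroJump hΔ)))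
  -- An embedding above `0'` absorbs it in the join and so computes `0''`.
  · exact hst.2.2 (hmain.trans (join_le hst.1.1 (TuringReducible.refl (S'.mapFun δ : ℕ →. ℕ))))
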